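/- Let $\Sigma$ be a finite alphabet with at least two letters. A 2-VASS $V$ over $\Sigma$ consists of a finite set $Q$ of states, an initial configuration $c_0\in Q\times\mathbb N^2$, a finite set $F\subseteq Q\times\mathbb N^2$ of final configurations and a finite transition relation $\delta\subseteq Q\times\Sigma\times\mathbb Z^2\times Q$. A transition $(s,a,v,s')\in\delta$ over the letter $a$ can be fired in a configuration $(q,u)\in Q\times\mathbb N^2$ iff $q=s$ and $u+v\ge 0$, and then leads to $(s',u+v)$. The trace language $L_T(V)$ is the set of all words read by sequences of transitions that can be fired one after another starting from $c_0$. $V$ is deterministic if for every state $q$ and every letter $a$ at most one transition over $a$ leaves $q$; "nondeterministic 2-VASS" means an arbitrary 2-VASS. A 2-VASS $V_0$ simulates a 2-VASS $V_1$ if Duplicator has a winning strategy in the following game, played from the initial configurations: in each round Spoiler fires a transition of $V_1$ in his current configuration, and Duplicator answers by firing, in his current configuration, a transition of $V_0$ over the same letter; a player who cannot move loses, and Duplicator wins infinite plays. $V_0$ and $V_1$ are in two-sided simulation if each simulates the other. Let $R$ be any equivalence relation on the set of all 2-VASSs over $\Sigma$ such that, for all 2-VASSs $A$ and $B$ over $\Sigma$,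 (1) if $A$ and $B$ are in two-sided simulation, then $(A,B)\in R$, and (2) if $L_T(A)\neq L_T(B)$, then $(A,B)\notin R$. Then it is undecidable, given a deterministic 2-VASS $A$ and a nondeterministic 2-VASS $B$ over $\Sigma$, whether $(A,B)\in R$. -/

import Mathlib

/-- A transition `(s, a, v, s')` of a `k`-dimensional VASS with states `Q` over the alphabet `α`. -/
structure VASSTransition (k : ℕ) (Q α : Type) where
  src : Q
  letter : α
  eff : Fin k → ℤ
  tgt : Q
deriving DecidableEq

/-- A `k`-dimensional vector addition system with states over the alphabet `α`: a finite set of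
states, an initial configuration, a finite set of final configurations and a finite set of
transitions. -/
structure VASS (k : ℕ) (α : Type) where
  Q : Type
  [fintypeQ : Fintype Q]
  init : Q × (Fin k → ℕ)
  final : Finset (Q × (Fin k → ℕ))
  trans : Finset (VASSTransition k Q α)

attribute [instance] VASS.fintypeQ

namespace VASS

variable {k : ℕ} {α : Type}

/-- Configurations `q(u)`. -/
abbrev Config (V : VASS k α) : Type := V.Q × (Fin k → ℕ)

/-- Transitions, possibly not belonging to the transition relation. -/
abbrev Trans (V : VASS k α) : Type := VASSTransition k V.Q α

/-- The transition `t` of `V` can be fired in `c`, and firing it leads to `c'`. The counters of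
`c'` are natural numbers, so no counter drops below zero. -/
def Fires (V : VASS k α) (t : V.Trans) (c c' : V.Config) : Prop :=
  t ∈ V.trans ∧ c.1 = t.src ∧ c'.1 = t.tgt ∧ ∀ i, (c'.2 i : ℤ) = (c.2 i : ℤ) + t.eff i

/-- `V.Run c ρ c'`: the sequence of transitions `ρ` is a run from `c` to `c'`. -/
inductive Run (V : VASS k α) : V.Config → List V.Trans → V.Config → Prop
  | nil (c : V.Config) : Run V c [] c
  | cons {c c' c'' : V.Config} {t : V.Trans} {ρ : List V.Trans} :
      V.Fires t c c' → Run V c' ρ c'' → Run V c (t :: ρ) c''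

/-- A configuration is accepting if it covers some final configuration. -/
def Accepting (V : VASS k α) (c : V.Config) : Prop :=
  ∃ f ∈ V.final, f.1 = c.1 ∧ f.2 ≤ c.2

/-- The coverability language `L(V)`. -/
def language (V : VASS k α) : Language α :=
  {w | ∃ ρ c, V.Run V.init ρ c ∧ V.Accepting c ∧ ρ.map VASSTransition.letter = w}

/-- The trace language `L_T(V)`: the coverability language for the set `Q × {0}` of final
configurations. -/
def traceLanguage (V : VASS k α) : Language α :=
  language { V with final := (Finset.univ : Finset V.Q) ×ˢ {0} }

/-- The trace language consists of the words that are read from the initial configuration. -/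
theorem mem_traceLanguage_iff (V : VASS k α) (w : List α) :
    w ∈ V.traceLanguage ↔ ∃ ρ c, V.Run V.init ρ c ∧ ρ.map VASSTransition.letter = w := by
  let W : VASS k α := { V with final := (Finset.univ : Finset V.Q) ×ˢ {0} }
  have h₁ : ∀ c ρ c', W.Run c ρ c' → V.Run c ρ c' := fun c ρ c' h =>
    Run.rec (V := W) (motive := fun c ρ c' _ => V.Run c ρ c') (fun c => Run.nil (V := V) c)
      (fun h _ ih => Run.cons (V := V) h ih) h
  have h₂ : ∀ c ρ c', V.Run c ρ c' → W.Run c ρ c' := fun c ρ c' h =>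
    Run.rec (V := V) (motive := fun c ρ c' _ => W.Run c ρ c') (fun c => Run.nil (V := W) c)
      (fun h _ ih => Run.cons (V := W) h ih) h
  constructor
  · rintro ⟨ρ, c, h, -, hw⟩
    exact ⟨ρ, c, h₁ _ _ _ h, hw⟩
  · rintro ⟨ρ, c, h, hw⟩
    exact ⟨ρ, c, h₂ _ _ _ h, ⟨(c.1, 0), by simp, rfl, fun i => Nat.zero_le _⟩, hw⟩

/-- For each state and each letter at most one transition leaves the state over the letter. -/
def Deterministic (V : VASS k α) : Prop :=
  ∀ t ∈ V.trans, ∀ t' ∈ V.trans, t.src = t'.src → t.letter = t'.letter → t = t'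

/-! ### The simulation game -/

/-- A past round of the game in which Spoiler plays in `V₁` and Duplicator plays in `V₀`: the
configurations of Spoiler and of Duplicator before the round and the transitions they chose. -/
abbrev Round (V₀ V₁ : VASS k α) : Type := V₁.Config × V₀.Config × V₁.Trans × V₀.Trans

/-- A strategy of Duplicator: given the past rounds, the current configurations of Spoiler and
of Duplicator, and the transition just chosen by Spoiler, it names a transition of Duplicator. -/
abbrev DuplicatorStrategy (V₀ V₁ : VASS k α) : Type :=
  List (Round V₀ V₁) → V₁.Config → V₀.Config → V₁.Trans → V₀.Trans

/-- `IsPlay V₀ V₁ σ h c₁ c₀`: from the initial configurations, a play in which Duplicator follows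
`σ` can have the past rounds `h` and now be at `c₁` for Spoiler and at `c₀` for Duplicator. -/
inductive IsPlay (V₀ V₁ : VASS k α) (σ : DuplicatorStrategy V₀ V₁) :
    List (Round V₀ V₁) → V₁.Config → V₀.Config → Prop
  | start : IsPlay V₀ V₁ σ [] V₁.init V₀.init
  | round {h : List (Round V₀ V₁)} {c₁ c₁' : V₁.Config} {c₀ c₀' : V₀.Config} {t : V₁.Trans} :
      IsPlay V₀ V₁ σ h c₁ c₀ → V₁.Fires t c₁ c₁' →
      V₀.Fires (σ h c₁ c₀ t) c₀ c₀' → (σ h c₁ c₀ t).letter = t.letter →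
      IsPlay V₀ V₁ σ (h ++ [(c₁, c₀, t, σ h c₁ c₀ t)]) c₁' c₀'

/-- The strategy `σ` is winning for Duplicator: in every play that follows `σ`, it answers each
move of Spoiler by a legal move over the same letter. So a play that follows `σ` either ends with
Spoiler being stuck or is infinite, and Duplicator wins in both cases. -/
def DuplicatorStrategy.Winning {V₀ V₁ : VASS k α} (σ : DuplicatorStrategy V₀ V₁) : Prop :=
  ∀ h c₁ c₀, IsPlay V₀ V₁ σ h c₁ c₀ → ∀ t c₁', V₁.Fires t c₁ c₁' →
    (σ h c₁ c₀ t).letter = t.letter ∧ ∃ c₀', V₀.Fires (σ h c₁ c₀ t) c₀ c₀'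

/-- `V₀` simulates `V₁` (from their initial configurations). -/
def Simulates (V₀ V₁ : VASS k α) : Prop :=
  ∃ σ : DuplicatorStrategy V₀ V₁, σ.Winning

/-- Two-sided simulation. -/
def TwoSidedSim (V₀ V₁ : VASS k α) : Prop :=
  V₀.Simulates V₁ ∧ V₁.Simulates V₀

/-! ### Finite descriptions and decidability -/

/-- A finite description of a `k`-VASS over the alphabet `Fin m`: a number `n`, giving the states
`0, …, n`, the initial configuration, a list of final configurations, and a list of transitions
`(s, a, v, s')`. -/
abbrev Code (k m : ℕ) : Type :=
  ℕ × (ℕ × (Fin k → ℕ)) × List (ℕ × (Fin k → ℕ)) × List (ℕ × Fin m × (Fin k → ℤ) × ℕ)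

/-- The VASS given by a description. State names are read modulo the number `n + 1` of states, so
that every description is meaningful. -/
def Code.toVASS {k m : ℕ} (c : Code k m) : VASS k (Fin m) where
  Q := Fin (c.1 + 1)
  init := (Fin.ofNat (c.1 + 1) c.2.1.1, c.2.1.2)
  final := (c.2.2.1.map fun f => (Fin.ofNat (c.1 + 1) f.1, f.2)).toFinset
  trans := (c.2.2.2.map fun t =>
    (⟨Fin.ofNat (c.1 + 1) t.1, t.2.1, t.2.2.1, Fin.ofNat (c.1 + 1) t.2.2.2⟩ :
      VASSTransition k (Fin (c.1 + 1)) (Fin m))).toFinset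

/-- Every VASS with the states `0, …, n` over the alphabet `Fin m` has a description. -/
theorem Code.exists_toVASS_eq {k m n : ℕ} (i : Fin (n + 1) × (Fin k → ℕ))
    (F : Finset (Fin (n + 1) × (Fin k → ℕ)))
    (δ : Finset (VASSTransition k (Fin (n + 1)) (Fin m))) :
    ∃ c : Code k m, Code.toVASS c = { Q := Fin (n + 1), init := i, final := F, trans := δ } := by
  refine ⟨(n, (i.1, i.2), F.toList.map fun f => ((f.1 : ℕ), f.2),
    δ.toList.map fun t => ((t.src : ℕ), t.letter, t.eff, (t.tgt : ℕ))), ?_⟩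
  simp only [Code.toVASS, List.map_map, Function.comp_def, Fin.ofNat_eq_cast, Fin.cast_val_eq_self,
    List.map_id', Finset.toList_toFinset, Prod.mk.eta]

end VASS

/-- The problem `p` is decidable under the promise `D`: some algorithm halts on every input that
satisfies `D` and answers there correctly whether the input satisfies `p`. -/
def DecidableUnderPromise {ι : Type} [Primcodable ι] (D p : ι → Prop) : Prop :=
  ∃ f : ι →. Bool, Partrec f ∧ ∀ x, D x → ∃ b ∈ f x, (b = true ↔ p x)

/-! The halting problem is reduced to the question. A vector machine adds a vector to its counters
when the result is nonnegative and branches otherwise, so it is a VASS with zero tests. Two such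
counters are universal: the first holds a product of prime powers whose exponents are registers, the
second is scratch space. Primitive recursive functions compile to register programs
(`exists_computes`). One outer loop then searches for a step bound within which a given code halts
on input 0. Thus a single fixed machine, started from counters that encode the code, has an
undecidable halting problem (`exists_universal_machine`).

From a machine one builds a deterministic VASS A. It reads `a` when it adds the vector and `b` when
it claims, unchecked, that the vector cannot be added; halting states have an `a`-loop. The
nondeterministic VASS B has an honest copy of A without the halting loops, and a full copy of A. On
a `b` in the honest copy, B may add the vector after all, which is possible exactly when the claim
is wrong. This leads to a pending state, and the next transition takes the vector back while it
imitates the next move of A and enters the full copy.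

A always simulates B (`claimVASS_answers`). If the machine never halts, B also simulates A: B
follows correct claims in the honest copy, which then never reaches a halting state, and refutes the
first wrong claim (`refuteVASS_answers`). If the machine halts, the word of its true computation
followed by `a` is a trace of A. It is not one of B: true claims cannot be refuted, so B is stuck in
an honest halting state (`not_run_refuteVASS`). Hence every relation between two-sided simulation
and trace equivalence contains (A, B) exactly when the machine does not halt. -/

/-! ### Vector machines -/

namespace VectorMachine

variable {k : ℕ}

/-- The instruction `(v, r, r')`: add `v` to the counters and go to `r`, or, if this would make a
counter negative, go to `r'`. -/
abbrev Instr (k : ℕ) : Type := (Fin k → ℤ) × ℕ × ℕ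

/-- Adding `v` to `u` keeps all counters nonnegative. -/
def Fireable (v : Fin k → ℤ) (u : Fin k → ℕ) : Prop := ∀ i, 0 ≤ (u i : ℤ) + v i

instance (v : Fin k → ℤ) (u : Fin k → ℕ) : Decidable (Fireable v u) := by
  unfold Fireable; infer_instance

/-- The counters after adding `v`. -/
def shift (v : Fin k → ℤ) (u : Fin k → ℕ) : Fin k → ℕ := fun i => ((u i : ℤ) + v i).toNat

theorem coe_shift {v : Fin k → ℤ} {u : Fin k → ℕ} (h : Fireable v u) (i : Fin k) :
    (shift v u i : ℤ) = u i + v i := Int.toNat_of_nonneg (h i)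

/-- One step of the machine; beyond the end of the instruction list it has halted. -/
def step (M : List (Instr k)) (c : ℕ × (Fin k → ℕ)) : ℕ × (Fin k → ℕ) :=
  match M[c.1]? with
  | none => c
  | some (v, r, r') => if Fireable v c.2 then (r, shift v c.2) else (r', c.2)

/-- `M` gets from `c` to `c'`. -/
def Reaches (M : List (Instr k)) (c c' : ℕ × (Fin k → ℕ)) : Prop := ∃ n, (step M)^[n] c = c'

/-- `M` gets from `c` to `c'` in at least one step. -/
def ReachesPlus (M : List (Instr k)) (c c' : ℕ × (Fin k → ℕ)) : Prop :=
  ∃ n, (step M)^[n + 1] c = c'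

theorem Reaches.refl (M : List (Instr k)) (c : ℕ × (Fin k → ℕ)) : Reaches M c c := ⟨0, rfl⟩

theorem Reaches.trans {M : List (Instr k)} {c c' c'' : ℕ × (Fin k → ℕ)} (h : Reaches M c c')
    (h' : Reaches M c' c'') : Reaches M c c'' := by
  obtain ⟨n, rfl⟩ := h
  obtain ⟨n', rfl⟩ := h'
  exact ⟨n' + n, Function.iterate_add_apply _ _ _ _⟩

theorem ReachesPlus.reaches {M : List (Instr k)} {c c' : ℕ × (Fin k → ℕ)}
    (h : ReachesPlus M c c') : Reaches M c c' := h.imp' _ fun _ => id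

theorem ReachesPlus.trans_reaches {M : List (Instr k)} {c c' c'' : ℕ × (Fin k → ℕ)}
    (h : ReachesPlus M c c') (h' : Reaches M c' c'') : ReachesPlus M c c'' := by
  obtain ⟨n, rfl⟩ := h
  obtain ⟨n', rfl⟩ := h'
  exact ⟨n' + n, Function.iterate_add_apply _ n' (n + 1) _⟩

theorem Reaches.trans_plus {M : List (Instr k)} {c c' c'' : ℕ × (Fin k → ℕ)}
    (h : Reaches M c c') (h' : ReachesPlus M c' c'') : ReachesPlus M c c'' := by
  obtain ⟨n, rfl⟩ := h
  obtain ⟨n', rfl⟩ := h'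
  exact ⟨n' + n, by rw [Nat.add_right_comm, Function.iterate_add_apply]⟩

/-- The machine halts from `c`. -/
def Halts (M : List (Instr k)) (c : ℕ × (Fin k → ℕ)) : Prop :=
  ∃ n, M.length ≤ ((step M)^[n] c).1

theorem step_of_length_le {M : List (Instr k)} {c : ℕ × (Fin k → ℕ)} (h : M.length ≤ c.1) :
    step M c = c := by
  simp [step, List.getElem?_eq_none h]

/-- A machine that can come back to `S` again and again does not halt from `S`. -/
theorem not_halts_of_forall_reachesPlus {M : List (Instr k)} (S : Set (ℕ × (Fin k → ℕ)))
    (hS : ∀ c ∈ S, c.1 < M.length) (h : ∀ c ∈ S, ∃ c' ∈ S, ReachesPlus M c c')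
    {c : ℕ × (Fin k → ℕ)} (hc : c ∈ S) : ¬ Halts M c := by
  rintro ⟨n, hn⟩
  induction n using Nat.strong_induction_on generalizing c with
  | _ n ih =>
    obtain ⟨c', hc', d, hd⟩ := h c hc
    -- A halted configuration is fixed. So if halting happens within `d` steps, the configuration
    -- `c'` after `d + 1` steps is halted as well, contrary to `hS`; otherwise the halting time from
    -- `c'` is smaller by `d + 1`.
    rcases le_or_gt n d with hnd | hnd
    · have hfix : ∀ j, (step M)^[j] ((step M)^[n] c) = (step M)^[n] c := fun j =>
        Function.iterate_fixed (step_of_length_le hn) j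
      have : (step M)^[d + 1] c = (step M)^[n] c := by
        rw [show d + 1 = (d + 1 - n) + n by omega, Function.iterate_add_apply, hfix]
      have h1 := hS c' hc'
      rw [← hd, this] at h1
      omega
    · refine ih (n - (d + 1)) (by omega) hc' ?_
      rw [← hd, ← Function.iterate_add_apply]
      rwa [Nat.sub_add_cancel (by omega)]

theorem step_append_fire {pre post : List (Instr k)} {v : Fin k → ℤ} {r r' : ℕ}
    {u : Fin k → ℕ} (h : Fireable v u) :
    step (pre ++ (v, r, r') :: post) (pre.length, u) = (r, shift v u) := by
  simp [step, h]

theorem step_append_not_fire {pre post : List (Instr k)} {v : Fin k → ℤ} {r r' : ℕ}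
    {u : Fin k → ℕ} (h : ¬ Fireable v u) :
    step (pre ++ (v, r, r') :: post) (pre.length, u) = (r', u) := by
  simp [step, h]

/-! ### Structured programs -/

/-- Structured programs. `loop C v B` runs `C`, leaves the loop if `v` cannot be added, and
otherwise adds `v`, runs `B` and starts again. -/
inductive Prog (k : ℕ) : Type
  | skip : Prog k
  | add (v : Fin k → ℤ) : Prog k
  | seq (P P' : Prog k) : Prog k
  | loop (C : Prog k) (v : Fin k → ℤ) (B : Prog k) : Prog k

namespace Prog

/-- The instructions of a program that is placed at the address `o`. -/
def code : Prog k → ℕ → List (Instr k)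
  | skip, _ => []
  | add v, o => [(v, o + 1, o + 1)]
  | seq P P', o => P.code o ++ P'.code (o + (P.code o).length)
  | loop C v B, o =>
    let c := C.code o
    let b := B.code (o + c.length + 1)
    c ++ (v, o + c.length + 1, o + c.length + 1 + b.length + 1) :: (b ++ [(0, o, o)])

/-- Wherever `P` is placed, it turns the counters `u` into `u'`. -/
def Does (P : Prog k) (u u' : Fin k → ℕ) : Prop :=
  ∀ pre post : List (Instr k), Reaches (pre ++ P.code pre.length ++ post) (pre.length, u)
    (pre.length + (P.code pre.length).length, u')

theorem does_skip (u : Fin k → ℕ) : skip.Does u u := fun _ _ => Reaches.refl _ _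

theorem does_add {v : Fin k → ℤ} {u u' : Fin k → ℕ} (h : ∀ i, (u' i : ℤ) = u i + v i) :
    (add v).Does u u' := by
  intro pre post
  have hf : Fireable v u := fun i => by rw [← h i]; positivity
  have : shift v u = u' := funext fun i => by exact_mod_cast (coe_shift hf i).trans (h i).symm
  refine ⟨1, ?_⟩
  rw [← this]
  simpa [code] using step_append_fire (pre := pre) (post := post) hf

theorem Does.seq {P P' : Prog k} {u u' u'' : Fin k → ℕ} (h : P.Does u u') (h' : P'.Does u' u'') :
    (P.seq P').Does u u'' := by
  intro pre post
  have h1 := h pre (P'.code (pre.length + (P.code pre.length).length) ++ post)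
  have h2 := h' (pre ++ P.code pre.length) post
  simp only [List.length_append, List.append_assoc] at h1 h2
  simp only [code, List.length_append, List.append_assoc, ← Nat.add_assoc]
  exact h1.trans h2

theorem does_loop_exit {C B : Prog k} {v : Fin k → ℤ} {u u' : Fin k → ℕ} (h : C.Does u u')
    (hv : ¬ Fireable v u') : (loop C v B).Does u u' := by
  intro pre post
  have h1 := h pre (((loop C v B).code pre.length).drop (C.code pre.length).length ++ post)
  simp only [code, List.drop_left] at h1
  simp only [code, List.append_assoc, List.cons_append] at h1 ⊢
  refine h1.trans ⟨1, ?_⟩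
  have h2 := step_append_not_fire (pre := pre ++ C.code pre.length)
    (post := B.code (pre.length + (C.code pre.length).length + 1) ++
      ([(0, pre.length, pre.length)] ++ post)) (v := v)
    (r := pre.length + (C.code pre.length).length + 1)
    (r' := pre.length + (C.code pre.length).length + 1 +
      (B.code (pre.length + (C.code pre.length).length + 1)).length + 1) hv
  simp only [List.length_append, List.append_assoc] at h2
  rw [Function.iterate_one]
  refine h2.trans ?_
  simp only [List.length_append, List.length_cons, List.length_nil, Prod.mk.injEq, and_true]
  omega

/-- One full round takes at least one step; this strictness is what later proves that an endless
loop does not halt. -/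
theorem reachesPlus_loop {C B : Prog k} {v : Fin k → ℤ} {u u₁ u₂ u₃ : Fin k → ℕ}
    (hC : C.Does u u₁) (hv : ∀ i, (u₂ i : ℤ) = u₁ i + v i) (hB : B.Does u₂ u₃)
    (pre post : List (Instr k)) :
    ReachesPlus (pre ++ (loop C v B).code pre.length ++ post) (pre.length, u) (pre.length, u₃) := by
  have hf : Fireable v u₁ := fun i => by rw [← hv i]; positivity
  have hs : shift v u₁ = u₂ := funext fun i => by exact_mod_cast (coe_shift hf i).trans (hv i).symm
  have h1 := hC pre (((loop C v B).code pre.length).drop (C.code pre.length).length ++ post)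
  simp only [code, List.drop_left] at h1
  simp only [code, List.append_assoc, List.cons_append] at h1 ⊢
  refine h1.trans_plus ?_
  set c := C.code pre.length
  set b := B.code (pre.length + c.length + 1) with hb
  set e := (v, pre.length + c.length + 1, pre.length + c.length + 1 + b.length + 1) with he
  have h2 := step_append_fire (pre := pre ++ c)
    (post := b ++ ([(0, pre.length, pre.length)] ++ post)) (v := v)
    (r := pre.length + c.length + 1) (r' := pre.length + c.length + 1 + b.length + 1) hf
  have h3 := hB (pre ++ c ++ [e]) ([(0, pre.length, pre.length)] ++ post)
  -- The zero vector can always be added, so the last instruction is an unconditional jump back.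
  have h4 := step_append_fire (pre := pre ++ c ++ [e] ++ b) (post := post) (v := 0)
    (r := pre.length) (r' := pre.length) (u := u₃) (fun i => by simp)
  have h5 : shift 0 u₃ = u₃ := funext fun i => by simp [shift]
  simp only [List.length_append, List.append_assoc, List.length_cons, List.length_nil, hs, h5,
    List.cons_append, List.nil_append, ← Nat.add_assoc, Nat.add_zero, ← hb, ← he] at h2 h3 h4 ⊢
  refine ReachesPlus.trans_reaches (c' := (pre.length + c.length + 1, u₂)) ⟨0, h2⟩ ?_
  rw [Nat.add_right_comm] at h4
  exact h3.trans ⟨1, h4⟩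

theorem does_loop_round {C B : Prog k} {v : Fin k → ℤ} {u u₁ u₂ u₃ u₄ : Fin k → ℕ}
    (hC : C.Does u u₁) (hv : ∀ i, (u₂ i : ℤ) = u₁ i + v i) (hB : B.Does u₂ u₃)
    (h : (loop C v B).Does u₃ u₄) : (loop C v B).Does u u₄ := fun pre post =>
  (reachesPlus_loop hC hv hB pre post).reaches.trans (h pre post)

/-! ### Two counters as a Gödel number -/

/-- Subtracting `x` until it fails is division with remainder; each subtraction pays `y` into the
second counter. -/
theorem does_drain_left (x y q r b : ℕ) (h : r < x) :
    (loop skip ![-(x : ℤ), y] skip).Does ![q * x + r, b] ![r, b + q * y] := by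
  induction q generalizing b with
  | zero =>
    simp only [Nat.zero_mul, Nat.zero_add, Nat.add_zero]
    exact does_loop_exit (does_skip _) fun hf => by have := hf 0; simp at this; omega
  | succ q ih =>
    have h2 : b + (q + 1) * y = (b + y) + q * y := by ring
    rw [h2]
    refine does_loop_round (does_skip _) (u₂ := ![q * x + r, b + y]) ?_ (does_skip _) (ih (b + y))
    simp [Fin.forall_fin_two]
    ring

theorem does_drain_right (y a b : ℕ) :
    (loop skip ![(y : ℤ), -1] skip).Does ![a, b] ![a + b * y, 0] := by
  induction b generalizing a with
  | zero =>
    simp only [Nat.zero_mul, Nat.add_zero]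
    exact does_loop_exit (does_skip _) fun hf => by have := hf 1; simp at this
  | succ b ih =>
    have h2 : a + (b + 1) * y = (a + y) + b * y := by ring
    rw [h2]
    refine does_loop_round (does_skip _) (u₂ := ![a + y, b]) ?_ (does_skip _) (ih (a + y))
    simp [Fin.forall_fin_two]

/-- Multiply the first counter by `p`. -/
def mulBy (p : ℕ) : Prog 2 :=
  (loop skip ![-((1 : ℕ) : ℤ), p] skip).seq (loop skip ![((1 : ℕ) : ℤ), -1] skip)

theorem does_mulBy (p a : ℕ) : (mulBy p).Does ![a, 0] ![a * p, 0] := by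
  have h1 := does_drain_left 1 p a 0 0 one_pos
  have h2 := does_drain_right 1 0 (0 + a * p)
  simp only [Nat.mul_one, Nat.add_zero, Nat.zero_add] at h1 h2
  exact h1.seq h2

/-- As long as the first counter is divisible by `p`, divide it by `p` and run `B`. In the end,
the first counter has been increased by `p - 1` and divided by `p`, with the quotient in the second
counter. -/
def divLoop (p : ℕ) (B : Prog 2) : Prog 2 :=
  loop ((add ![(p : ℤ) - 1, 0]).seq (loop skip ![-(p : ℤ), (1 : ℕ)] skip)) ![1 - (p : ℤ), 0]
    ((loop skip ![((1 : ℕ) : ℤ), -1] skip).seq B)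

/-- As long as the first counter is divisible by `p`, divide it by `p` and run `B`. -/
def whileDvd (p : ℕ) (B : Prog 2) : Prog 2 :=
  (divLoop p B).seq ((loop skip ![(p : ℤ), -1] skip).seq (add ![1 - (p : ℤ), 0]))

/-- Adding `p - 1` first makes the remainder equal to `p - 1`, the largest possible one, exactly
when `p` divides the original number. So divisibility becomes the fireability of `1 - p` on the
first counter, which is the kind of test that a loop performs. -/
theorem does_divLoop_test {p r : ℕ} (q : ℕ) (h : r < p) :
    ((add ![(p : ℤ) - 1, 0]).seq (loop skip ![-(p : ℤ), (1 : ℕ)] skip)).Does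
      ![q * p + r + 1, 0] ![r, q + 1] := by
  have h1 := does_drain_left p 1 (q + 1) r 0 h
  simp only [Nat.mul_one, Nat.zero_add] at h1
  refine Does.seq (does_add ?_) h1
  simp [Fin.forall_fin_two]
  ring

theorem does_divLoop_of_not_dvd {p a : ℕ} (B : Prog 2) (hp : 0 < p) (h : ¬ p ∣ a) :
    (divLoop p B).Does ![a, 0] ![a % p - 1, a / p + 1] := by
  have h0 : 0 < a % p := Nat.pos_of_ne_zero fun h' => h (Nat.dvd_of_mod_eq_zero h')
  have h1 := Nat.mod_lt a hp
  have h2 := does_divLoop_test (p := p) (a / p) (r := a % p - 1) (by omega)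
  have h3 : a / p * p + (a % p - 1) + 1 = a := by
    have := Nat.div_add_mod' a p
    omega
  rw [h3] at h2
  have hv : ¬ Fireable ![1 - (p : ℤ), 0] ![a % p - 1, a / p + 1] := fun hf => by
    have := hf 0
    simp only [Matrix.cons_val_zero] at this
    omega
  exact does_loop_exit h2 hv

/-- Multiplying back gives `(a % p - 1) + (a / p + 1) * p = a + p - 1`, and the surplus `p - 1` is
then removed. -/
theorem does_undo_divLoop {p a : ℕ} (h : ¬ p ∣ a) :
    ((loop skip ![(p : ℤ), -1] skip).seq (add ![1 - (p : ℤ), 0])).Does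
      ![a % p - 1, a / p + 1] ![a, 0] := by
  refine (does_drain_right p _ _).seq (does_add ?_)
  have h0 : 0 < a % p := Nat.pos_of_ne_zero fun h' => h (Nat.dvd_of_mod_eq_zero h')
  have h1 := Nat.div_add_mod' a p
  simp only [Fin.forall_fin_two, Matrix.cons_val_zero, Matrix.cons_val_one, Nat.succ_mul]
  omega

theorem does_divLoop_round (p a : ℕ) (hp : 0 < p) :
    ((add ![(p : ℤ) - 1, 0]).seq (loop skip ![-(p : ℤ), (1 : ℕ)] skip)).Does ![a * p, 0]
      ![p - 1, a] := by
  have h1 := does_drain_left p 1 a (p - 1) 0 (by omega)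
  simp only [Nat.mul_one, Nat.zero_add] at h1
  refine Does.seq (does_add ?_) h1
  simp [Fin.forall_fin_two]
  omega

theorem does_drain_one_seq {B : Prog 2} {a : ℕ} {u : Fin 2 → ℕ} (hB : B.Does ![a, 0] u) :
    ((loop skip ![((1 : ℕ) : ℤ), -1] skip).seq B).Does ![0, a] u := by
  have h1 := does_drain_right 1 0 a
  simp only [Nat.mul_one, Nat.zero_add] at h1
  exact h1.seq hB

theorem reachesPlus_divLoop {p a : ℕ} {B : Prog 2} {u : Fin 2 → ℕ} (hp : 0 < p)
    (hB : B.Does ![a, 0] u) :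
    ReachesPlus ((divLoop p B).code 0) (0, ![a * p, 0]) (0, u) := by
  have := reachesPlus_loop (does_divLoop_round p a hp) (v := ![1 - (p : ℤ), 0]) (u₂ := ![0, a])
    (by simp [Fin.forall_fin_two]; omega) (does_drain_one_seq hB) [] []
  simpa [divLoop] using this

theorem does_divLoop_of_does {p a : ℕ} {B : Prog 2} {u u' : Fin 2 → ℕ} (hp : 0 < p)
    (hB : B.Does ![a, 0] u) (h : (divLoop p B).Does u u') :
    (divLoop p B).Does ![a * p, 0] u' :=
  does_loop_round (does_divLoop_round p a hp) (u₂ := ![0, a])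
    (by simp [Fin.forall_fin_two]; omega) (does_drain_one_seq hB) h

end Prog

/-! ### Registers -/

/-- The `i`-th prime number. -/
noncomputable def prime (i : ℕ) : ℕ := Nat.nth Nat.Prime i

theorem prime_prime (i : ℕ) : (prime i).Prime := Nat.prime_nth_prime i

theorem prime_inj {i j : ℕ} : prime i = prime j ↔ i = j :=
  (Nat.nth_injective Nat.infinite_setOfPred_prime).eq_iff

/-- The number `a` represents the register contents `s`: the exponent of the `i`-th prime number
in `a` is `s i`. -/
def Represents (a : ℕ) (s : ℕ → ℕ) : Prop := a ≠ 0 ∧ ∀ i, a.factorization (prime i) = s i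

theorem represents_mul_prime {a : ℕ} {s : ℕ → ℕ} (i : ℕ) (h : Represents a s) :
    Represents (a * prime i) (Function.update s i (s i + 1)) := by
  refine ⟨mul_ne_zero h.1 (prime_prime i).ne_zero, fun j => ?_⟩
  rw [Nat.factorization_mul h.1 (prime_prime i).ne_zero, Finsupp.add_apply, h.2 j,
    (prime_prime i).factorization, Finsupp.single_apply, Function.update_apply]
  simp only [prime_inj]
  grind

theorem Represents.dvd_iff {a : ℕ} {s : ℕ → ℕ} (h : Represents a s) (i : ℕ) :
    prime i ∣ a ↔ s i ≠ 0 := by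
  rw [← h.2 i, (prime_prime i).dvd_iff_one_le_factorization h.1, Nat.one_le_iff_ne_zero]

theorem Represents.exists_eq_mul {a : ℕ} {s : ℕ → ℕ} (h : Represents a s) {i : ℕ}
    (hi : s i ≠ 0) :
    ∃ b, a = b * prime i ∧ Represents b (Function.update s i (s i - 1)) := by
  obtain ⟨b, rfl⟩ := (h.dvd_iff i).2 hi
  have hb : b ≠ 0 := right_ne_zero_of_mul h.1
  refine ⟨b, mul_comm _ _, hb, fun j => ?_⟩
  have hj := h.2 j
  rw [Nat.factorization_mul (prime_prime i).ne_zero hb, Finsupp.add_apply,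
    (prime_prime i).factorization, Finsupp.single_apply] at hj
  simp only [prime_inj] at hj
  rw [Function.update_apply]
  grind

/-- The program turns the register contents `s` into `s'`. -/
def Transforms (P : Prog 2) (s s' : ℕ → ℕ) : Prop :=
  ∀ a, Represents a s → ∃ a', Represents a' s' ∧ P.Does ![a, 0] ![a', 0]

/-- Increment the register `i`. -/
noncomputable def inc (i : ℕ) : Prog 2 := Prog.mulBy (prime i)

/-- As long as the register `i` is not zero, decrement it and run `B`. -/
noncomputable def whileDec (i : ℕ) (B : Prog 2) : Prog 2 := Prog.whileDvd (prime i) B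

theorem transforms_skip (s : ℕ → ℕ) : Transforms .skip s s :=
  fun a h => ⟨a, h, Prog.does_skip _⟩

theorem Transforms.seq {P P' : Prog 2} {s s' s'' : ℕ → ℕ} (h : Transforms P s s')
    (h' : Transforms P' s' s'') : Transforms (P.seq P') s s'' := by
  intro a ha
  obtain ⟨b, hb, h1⟩ := h a ha
  obtain ⟨c, hc, h2⟩ := h' b hb
  exact ⟨c, hc, h1.seq h2⟩

theorem transforms_inc (i : ℕ) (s : ℕ → ℕ) :
    Transforms (inc i) s (Function.update s i (s i + 1)) :=
  fun a h => ⟨_, represents_mul_prime i h, Prog.does_mulBy _ a⟩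

/-- The family `σ` is the loop invariant: `σ j` gives the registers after `j` rounds, and the body
starts with register `i` already decremented. -/
theorem transforms_whileDec {i n : ℕ} {B : Prog 2} (σ : ℕ → ℕ → ℕ)
    (hi : ∀ j ≤ n, σ j i = n - j)
    (hB : ∀ j < n, Transforms B (Function.update (σ j) i (n - j - 1)) (σ (j + 1))) :
    Transforms (whileDec i B) (σ 0) (σ n) := by
  -- The induction on the remaining rounds concerns `divLoop` alone. Its exit counters `w` are kept
  -- separate because the restoring tail runs only once, at the end.
  suffices H : ∀ d j, j + d = n → ∀ a, Represents a (σ j) → ∃ a' w, Represents a' (σ n) ∧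
      (Prog.divLoop (prime i) B).Does ![a, 0] w ∧
      ((Prog.loop .skip ![(prime i : ℤ), -1] .skip).seq (.add ![1 - (prime i : ℤ), 0])).Does w
        ![a', 0] by
    intro a ha
    obtain ⟨a', w, h, h1, h2⟩ := H n 0 (Nat.zero_add n) a ha
    exact ⟨a', h, h1.seq h2⟩
  intro d
  induction d with
  | zero =>
    rintro j rfl a ha
    have hdvd : ¬ prime i ∣ a := by
      rw [ha.dvd_iff, hi j le_rfl]
      simp
    exact ⟨a, _, ha, Prog.does_divLoop_of_not_dvd B (prime_prime i).pos hdvd,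
      Prog.does_undo_divLoop hdvd⟩
  | succ d ih =>
    intro j hj a ha
    have hij := hi j (by omega)
    obtain ⟨b, rfl, hb⟩ := ha.exists_eq_mul (i := i) (by omega)
    rw [hij] at hb
    obtain ⟨c, hc, h1⟩ := hB j (by omega) b hb
    obtain ⟨a', w, h2, h3, h4⟩ := ih (j + 1) (by omega) c hc
    exact ⟨a', w, h2, Prog.does_divLoop_of_does (prime_prime i).pos h1 h3, h4⟩

/-- Set the register `i` to zero. -/
noncomputable def clear (i : ℕ) : Prog 2 := whileDec i .skip

theorem transforms_clear (i : ℕ) (s : ℕ → ℕ) :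
    Transforms (clear i) s (Function.update s i 0) := by
  have h := transforms_whileDec (i := i) (n := s i) (B := .skip)
    (fun j => Function.update s i (s i - j)) (by simp) (fun j _ => by
      simpa [Nat.sub_sub] using transforms_skip _)
  simpa [clear] using h

/-- Add the register `i` to the register `j` and set it to zero. -/
noncomputable def move (i j : ℕ) : Prog 2 := whileDec i (inc j)

theorem transforms_move {i j : ℕ} (hij : i ≠ j) (s : ℕ → ℕ) :
    Transforms (move i j) s (Function.update (Function.update s j (s j + s i)) i 0) := by
  have h := transforms_whileDec (i := i) (n := s i) (B := inc j)
    (fun d => Function.update (Function.update s j (s j + d)) i (s i - d)) (by simp)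
    (fun d _ => by
      convert transforms_inc j _ using 1
      funext r
      simp only [Function.update_apply]
      grind)
  simpa [move] using h

/-- Add the register `i` to the register `j`, with the scratch register `t`. -/
noncomputable def copy (i j t : ℕ) : Prog 2 := (whileDec i ((inc j).seq (inc t))).seq (move t i)

theorem transforms_copy {i j t : ℕ} (hij : i ≠ j) (hit : i ≠ t) (hjt : j ≠ t) {s : ℕ → ℕ}
    (ht : s t = 0) : Transforms (copy i j t) s (Function.update s j (s j + s i)) := by
  have h := transforms_whileDec (i := i) (n := s i) (B := (inc j).seq (inc t))
    (fun d => Function.update (Function.update (Function.update s j (s j + d)) t d) i (s i - d))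
    (by simp)
    (fun d _ => by
      refine (transforms_inc j _).seq ?_
      convert transforms_inc t _ using 1
      funext r
      simp only [Function.update_apply]
      grind)
  -- The invariant starts at `s` itself because the scratch register is zero.
  have h0 : Function.update (Function.update (Function.update s j (s j + 0)) t 0) i (s i - 0) =
      s := by
    funext r
    simp only [Function.update_apply]
    grind
  rw [h0] at h
  refine h.seq ?_
  convert transforms_move hit.symm _ using 1
  funext r
  simp only [Function.update_apply]
  grind

/-! ### Compiling primitive recursive functions -/

/-- The program `P` computes `f` from the registers `ins`: if all registers from `base` on are zero,
then it writes the value to the register `base` and leaves all other registers as they were. -/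
def Computes {n : ℕ} (P : Prog 2) (f : List.Vector ℕ n → ℕ) (ins : Fin n → ℕ) (base : ℕ) : Prop :=
  ∀ s : ℕ → ℕ, (∀ r, base ≤ r → s r = 0) →
    Transforms P s (Function.update s base (f (List.Vector.ofFn fun i => s (ins i))))

theorem exists_clear_range (a n : ℕ) : ∃ P, ∀ s : ℕ → ℕ,
    Transforms P s (fun r => if a ≤ r ∧ r < a + n then 0 else s r) := by
  induction n with
  | zero =>
    refine ⟨.skip, fun s => ?_⟩
    convert transforms_skip s using 1
    funext r
    grind
  | succ n ih =>
    obtain ⟨P, hP⟩ := ih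
    refine ⟨P.seq (clear (a + n)), fun s => (hP s).seq ?_⟩
    convert transforms_clear (a + n) _ using 1
    funext r
    simp only [Function.update_apply]
    grind

/-- The values of the functions `g` at `v`, continued by zero. -/
def valueAt {m n : ℕ} (g : Fin n → List.Vector ℕ m → ℕ) (v : List.Vector ℕ m) (j : ℕ) : ℕ :=
  if h : j < n then g ⟨j, h⟩ v else 0

/-- Each function is computed with its base raised past the values already stored; the inputs lie
below `base` and stay intact. -/
theorem exists_computes_all {m n : ℕ} {g : Fin n → List.Vector ℕ m → ℕ}
    (hg : ∀ i (ins : Fin m → ℕ) (base : ℕ), (∀ j, ins j < base) → ∃ P, Computes P (g i) ins base)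
    (ins : Fin m → ℕ) (base : ℕ) (hins : ∀ j, ins j < base) (k : ℕ) (hk : k ≤ n) :
    ∃ P, ∀ s : ℕ → ℕ, (∀ r, base ≤ r → s r = 0) → Transforms P s (fun r =>
      if base ≤ r ∧ r < base + k then
        valueAt g (List.Vector.ofFn fun i => s (ins i)) (r - base) else s r) := by
  induction k with
  | zero =>
    refine ⟨.skip, fun s _ => ?_⟩
    convert transforms_skip s using 1
    funext r
    grind
  | succ k ih =>
    obtain ⟨P, hP⟩ := ih (by omega)
    obtain ⟨P', hP'⟩ := hg ⟨k, by omega⟩ ins (base + k) (fun j => (hins j).trans_le (by omega))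
    refine ⟨P.seq P', fun s hs => (hP s hs).seq ?_⟩
    convert hP' _ _ using 1
    · funext r
      have h2 : ∀ i, ¬ (base ≤ ins i ∧ ins i < base + k) := fun i => by have := hins i; omega
      simp only [Function.update_apply, h2, if_false]
      rcases eq_or_ne r (base + k) with rfl | hr
      · simp [valueAt, show k < n by omega]
      · have : (base ≤ r ∧ r < base + (k + 1)) ↔ base ≤ r ∧ r < base + k := by omega
        simp only [this, hr, if_false]
    · intro r hr
      rw [if_neg (by omega), hs r (by omega)]

/-- Induction on the construction of `f`, with the registers from `base` on used as a stack: a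
subprogram gets a higher base and leaves only its value there. -/
theorem exists_computes {n : ℕ} {f : List.Vector ℕ n → ℕ} (hf : Nat.Primrec' f) :
    ∀ (ins : Fin n → ℕ) (base : ℕ), (∀ j, ins j < base) → ∃ P, Computes P f ins base := by
  induction hf with
  | zero =>
    refine fun ins base _ => ⟨.skip, fun s hs => ?_⟩
    convert transforms_skip s using 1
    simp [← hs base le_rfl]
  | succ =>
    refine fun ins base h => ⟨(copy (ins 0) base (base + 1)).seq (inc base), fun s hs => ?_⟩
    have h0 := h 0
    refine (transforms_copy (by omega) (by omega) (by omega) (hs _ (by omega))).seq ?_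
    convert transforms_inc base _ using 1
    simp [hs base le_rfl]
  | get i =>
    refine fun ins base h => ⟨copy (ins i) base (base + 1), fun s hs => ?_⟩
    have h0 := h i
    convert transforms_copy (i := ins i) (j := base) (t := base + 1) (by omega) (by omega)
      (by omega) (hs _ (by omega)) using 1
    simp [hs base le_rfl]
  -- The inner values go to the `n` registers from `base + 1` on and the outer value to `base + 1 +
  -- n`. The outer value is then moved to `base`, kept zero until then, and the inner values are
  -- cleared.
  | @comp m n f g hf hg ihf ihg =>
    intro ins base h
    obtain ⟨P, hP⟩ := exists_computes_all ihg ins (base + 1)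
      (fun j => (h j).trans_le (by omega)) n le_rfl
    obtain ⟨P', hP'⟩ := ihf (fun i => base + 1 + i) (base + 1 + n) (fun j => by omega)
    obtain ⟨P'', hP''⟩ := exists_clear_range (base + 1) n
    refine ⟨P.seq (P'.seq ((move (base + 1 + n) base).seq P'')), fun s hs => ?_⟩
    refine (hP s fun r hr => hs r (by omega)).seq
      ((hP' _ fun r hr => ?_).seq ((transforms_move (by omega) _).seq ?_))
    · rw [if_neg (by omega), hs r (by omega)]
    convert hP'' _ using 1
    funext r
    have h0 := hs r
    have h1 : (List.Vector.ofFn fun i : Fin n => if base + 1 ≤ base + 1 + (i : ℕ) ∧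
        base + 1 + (i : ℕ) < base + 1 + n then valueAt g (List.Vector.ofFn fun i => s (ins i))
        (base + 1 + i - (base + 1)) else s (base + 1 + i)) =
        List.Vector.ofFn fun i => g i (List.Vector.ofFn fun i => s (ins i)) := by
      congr 1
      funext i
      simp [valueAt]
    rw [h1]
    simp only [Function.update_apply]
    grind
  -- Register `base` holds the accumulator, `base + 1` the recursion index, and `base + 2` the
  -- number of rounds left. Each round computes the next value in `base + 3` and moves it to `base`.
  | @prec n f g hf hg ihf ihg =>
    intro ins base h
    obtain ⟨P, hP⟩ := ihf (fun i => ins i.succ) base (fun j => h _)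
    obtain ⟨P', hP'⟩ := ihg (Fin.cons (base + 1) (Fin.cons base fun i => ins i.succ)) (base + 3)
      (by
        refine Fin.cases (by simp) (Fin.cases (by simp) fun j => ?_)
        simpa using (h j.succ).trans_le (by omega))
    refine ⟨P.seq ((copy (ins 0) (base + 2) (base + 3)).seq ((whileDec (base + 2)
      (P'.seq ((clear base).seq ((move (base + 3) base).seq (inc (base + 1)))))).seq
        (clear (base + 1)))), fun s hs => ?_⟩
    set c := s (ins 0) with hc
    set v := List.Vector.ofFn fun i : Fin n => s (ins i.succ) with hv
    set val : ℕ → ℕ := fun y => y.rec (f v) fun y IH => g (y ::ᵥ IH ::ᵥ v) with hval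
    refine (hP s hs).seq ((transforms_copy ?_ ?_ ?_ ?_).seq (Transforms.seq
      (s' := Function.update (Function.update s base (val c)) (base + 1) c) ?_ ?_))
    · have := h 0; omega
    · have := h 0; omega
    · omega
    · simp [hs]
    · have key := transforms_whileDec (i := base + 2) (n := c)
        (B := P'.seq ((clear base).seq ((move (base + 3) base).seq (inc (base + 1)))))
        (fun j => Function.update (Function.update (Function.update s base (val j)) (base + 1) j)
          (base + 2) (c - j)) (by simp) (fun j hj => ?_)
      · convert key using 1
        · funext r
          have h0 := h 0
          have h1 := hs (base + 1) (by omega)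
          have h2 := hs (base + 2) (by omega)
          have h3 : val 0 = f v := rfl
          simp only [Function.update_apply, ← hv, ← hc, h3]
          grind
        · funext r
          have h2 := hs (base + 2) (by omega)
          simp only [Function.update_apply]
          grind
      · refine (hP' _ fun r hr => ?_).seq ((transforms_clear _ _).seq
          ((transforms_move (by omega) _).seq ?_))
        · have := hs r (by omega)
          simp only [Function.update_apply]
          grind
        convert transforms_inc (base + 1) _ using 1
        have hvec : (List.Vector.ofFn fun i : Fin (n + 2) => Function.update (Function.update
            (Function.update (Function.update s base (val j)) (base + 1) j) (base + 2) (c - j))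
            (base + 2) (c - j - 1)
            ((Fin.cons (base + 1) (Fin.cons base fun i => ins i.succ) : Fin (n + 2) → ℕ) i)) =
            j ::ᵥ val j ::ᵥ v := by
          have : ∀ i : Fin n, ins i.succ ≠ base ∧ ins i.succ ≠ base + 1 ∧ ins i.succ ≠ base + 2 :=
            fun i => by have := h i.succ; omega
          simp [List.Vector.ofFn, hv, this]
        have hsucc : val (j + 1) = g (j ::ᵥ val j ::ᵥ v) := rfl
        rw [hvec, ← hsucc]
        funext r
        have h3 := hs (base + 3) (by omega)
        have h4 : c - (j + 1) = c - j - 1 := by omega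
        simp only [Function.update_apply, h4]
        grind
    · convert transforms_clear (base + 1) _ using 1
      have hvec : (List.Vector.ofFn fun i => s (ins i)) = c ::ᵥ v := rfl
      funext r
      have h1 := hs (base + 1) (by omega)
      simp only [Function.update_apply, hvec, List.Vector.head_cons, List.Vector.tail_cons]
      grind

/-! ### A machine with an undecidable halting problem -/

theorem represents_mul_pow {a : ℕ} {s : ℕ → ℕ} (i e : ℕ) (h : Represents a s) :
    Represents (a * prime i ^ e) (Function.update s i (s i + e)) := by
  induction e with
  | zero => simpa using h
  | succ e ih =>
    rw [pow_succ, ← mul_assoc]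
    convert represents_mul_prime i ih using 1
    simp [Nat.add_assoc]

/-- Unbounded search is one loop controlled by a flag. Register 0 holds `e`, register 1 the
candidate `k`, and register 2 the flag, initially 1. Each round consumes the flag, writes `g (e, k)`
in its place and increments `k`, so the loop ends at the first zero of `g`. -/
theorem exists_machine {g : List.Vector ℕ 2 → ℕ} (hg : Nat.Primrec' g) (hg1 : ∀ v, g v ≤ 1) :
    ∃ M : List (Instr 2), ∀ e, Halts M (0, ![prime 2 * prime 0 ^ e, 0]) ↔
      ∃ k, g (e ::ᵥ k ::ᵥ List.Vector.nil) = 0 := by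
  obtain ⟨P, hP⟩ := exists_computes hg ![0, 1] 2 (by simp [Fin.forall_fin_two])
  set B := P.seq (inc 1) with hB
  refine ⟨(Prog.divLoop (prime 2) B).code 0, fun e => ?_⟩
  set st : ℕ → ℕ → ℕ → ℕ := fun k x r =>
    if r = 0 then e else if r = 1 then k else if r = 2 then x else 0 with hst
  have hround : ∀ k a, Represents a (st k 1) → ∃ b c, a = b * prime 2 ∧
      Represents c (st (k + 1) (g (e ::ᵥ k ::ᵥ List.Vector.nil))) ∧ B.Does ![b, 0] ![c, 0] := by
    intro k a ha
    obtain ⟨b, rfl, hb⟩ := ha.exists_eq_mul (i := 2) (by simp [hst])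
    have h1 : Function.update (st k 1) 2 (st k 1 2 - 1) = st k 0 := by
      funext r
      simp only [Function.update_apply, hst]
      grind
    rw [h1] at hb
    have h2 := (hP (st k 0) (fun r hr => by simp only [hst]; grind)).seq (transforms_inc 1 _)
    have hvec : (List.Vector.ofFn fun i => st k 0 (![0, 1] i)) = e ::ᵥ k ::ᵥ List.Vector.nil := by
      simp [List.Vector.ofFn, hst]
    rw [hvec] at h2
    obtain ⟨c, hc, hd⟩ := h2 b hb
    refine ⟨b, c, rfl, ?_, hd⟩
    convert hc using 1
    funext r
    simp only [Function.update_apply, hst]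
    grind
  have hinit : Represents (prime 2 * prime 0 ^ e) (st 0 1) := by
    have h1 := represents_mul_pow 0 e
      (represents_mul_prime 2 (a := 1) (s := 0) ⟨one_ne_zero, by simp⟩)
    rw [one_mul] at h1
    convert h1 using 1
    funext r
    simp only [Function.update_apply, hst, Pi.zero_apply]
    grind
  constructor
  · contrapose!
    intro h
    have h1 : ∀ k, g (e ::ᵥ k ::ᵥ List.Vector.nil) = 1 := fun k =>
      le_antisymm (hg1 _) (Nat.one_le_iff_ne_zero.2 (h k))
    refine not_halts_of_forall_reachesPlus
      {c | ∃ k a, Represents a (st k 1) ∧ c = (0, ![a, 0])} ?_ ?_ ⟨0, _, hinit, rfl⟩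
    · rintro _ ⟨k, a, -, rfl⟩
      simp [Prog.divLoop, Prog.code]
    · rintro _ ⟨k, a, ha, rfl⟩
      obtain ⟨b, c, rfl, hc, hd⟩ := hround k a ha
      rw [h1 k] at hc
      exact ⟨_, ⟨k + 1, c, hc, rfl⟩, Prog.reachesPlus_divLoop (prime_prime 2).pos hd⟩
  · rintro ⟨K, hK⟩
    -- Here `K` need not be the first zero: the loop may end earlier, and `d` only bounds the rounds
    -- left before the one that tests `K`.
    suffices H : ∀ d k, k + d = K → ∀ a, Represents a (st k 1) →
        ∃ w, (Prog.divLoop (prime 2) B).Does ![a, 0] w by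
      obtain ⟨w, hw⟩ := H K 0 (Nat.zero_add K) _ hinit
      obtain ⟨n, hn⟩ := hw [] []
      refine ⟨n, ?_⟩
      simp only [List.nil_append, List.append_nil, List.length_nil, Nat.zero_add] at hn
      rw [hn]
    intro d
    induction d with
    | zero =>
      rintro k rfl a ha
      obtain ⟨b, c, rfl, hc, hd⟩ := hround k a ha
      rw [Nat.add_zero] at hK
      have hdvd : ¬ prime 2 ∣ c := by
        rw [hc.dvd_iff, hK]
        simp [hst]
      exact ⟨_, Prog.does_divLoop_of_does (prime_prime 2).pos hd
        (Prog.does_divLoop_of_not_dvd B (prime_prime 2).pos hdvd)⟩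
    | succ d ih =>
      intro k hk a ha
      obtain ⟨b, c, rfl, hc, hd⟩ := hround k a ha
      rcases Nat.le_one_iff_eq_zero_or_eq_one.1 (hg1 (e ::ᵥ k ::ᵥ List.Vector.nil)) with h0 | h1
      · rw [h0] at hc
        have hdvd : ¬ prime 2 ∣ c := by
          rw [hc.dvd_iff]
          simp [hst]
        exact ⟨_, Prog.does_divLoop_of_does (prime_prime 2).pos hd
          (Prog.does_divLoop_of_not_dvd B (prime_prime 2).pos hdvd)⟩
      · rw [h1] at hc
        obtain ⟨w, hw⟩ := ih (k + 1) (by omega) c hc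
        exact ⟨w, Prog.does_divLoop_of_does (prime_prime 2).pos hd hw⟩

theorem exists_universal_machine : ∃ M : List (Instr 2), ∀ c : Nat.Partrec.Code,
    Halts M (0, ![prime 2 * prime 0 ^ Encodable.encode c, 0]) ↔ (c.eval 0).Dom := by
  -- True means that no value is found within the bound `k`, so the search for a zero is the search
  -- for a sufficient bound.
  let φ : ℕ → ℕ → Bool := fun e k =>
    ((Nat.Partrec.Code.evaln k (Denumerable.ofNat Nat.Partrec.Code e) 0).isNone)
  have hφ : Primrec₂ φ := by
    have h1 : Primrec₂ fun e k : ℕ =>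
        Nat.Partrec.Code.evaln k (Denumerable.ofNat Nat.Partrec.Code e) 0 :=
      (Nat.Partrec.Code.primrec_evaln.comp
        ((Primrec.snd.pair ((Primrec.ofNat _).comp Primrec.fst)).pair (Primrec.const 0)))
    have h2 : Primrec fun o : Option ℕ => o.isNone := by
      refine (Primrec.not.comp Primrec.option_isSome).of_eq fun o => ?_
      cases o <;> rfl
    exact h2.comp₂ h1
  have hg : Nat.Primrec' fun v : List.Vector ℕ 2 => (φ v.head v.tail.head).toNat := by
    refine (Nat.Primrec'.prim_iff₂ (f := fun e k => (φ e k).toNat)).2 ?_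
    have h2 : Primrec Bool.toNat := Primrec.dom_finite _
    exact h2.comp₂ hφ
  obtain ⟨M, hM⟩ := exists_machine hg (fun v => Bool.toNat_le _)
  refine ⟨M, fun c => (hM _).trans ?_⟩
  simp only [List.Vector.head_cons, List.Vector.tail_cons, Bool.toNat_eq_zero, φ,
    Denumerable.ofNat_encode, Part.dom_iff_mem, Nat.Partrec.Code.evaln_complete]
  constructor
  · rintro ⟨k, hk⟩
    obtain ⟨x, hx⟩ := Option.ne_none_iff_exists'.1 (Option.isNone_eq_false_iff.1 hk |>
      Option.isSome_iff_ne_none.1)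
    exact ⟨x, k, hx⟩
  · rintro ⟨x, k, hx⟩
    exact ⟨k, by rw [Option.mem_def.1 hx]; rfl⟩

end VectorMachine

namespace VASS

variable {k : ℕ} {α : Type}

/-! ### Simulation and relabelling of states -/

/-- Duplicator wins if he can maintain a relation between the configurations. -/
theorem simulates_of_relation {V₀ V₁ : VASS k α} (S : V₁.Config → V₀.Config → Prop)
    (hinit : S V₁.init V₀.init)
    (hS : ∀ c₁ c₀, S c₁ c₀ → ∀ t c₁', V₁.Fires t c₁ c₁' →
      ∃ t₀ c₀', V₀.Fires t₀ c₀ c₀' ∧ t₀.letter = t.letter ∧ S c₁' c₀') : V₀.Simulates V₁ := by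
  classical
  let Good : V₁.Config → V₀.Config → V₁.Trans → V₀.Trans → Prop := fun c₁ c₀ t t₀ =>
    t₀.letter = t.letter ∧ (∃ c₀', V₀.Fires t₀ c₀ c₀') ∧
      ∀ c₁' c₀', V₁.Fires t c₁ c₁' → V₀.Fires t₀ c₀ c₀' → S c₁' c₀'
  have functional : ∀ (V : VASS k α) (t : V.Trans) (c c' c'' : V.Config), V.Fires t c c' →
      V.Fires t c c'' → c' = c'' := by
    rintro V t c c' c'' ⟨-, -, h1, h2⟩ ⟨-, -, h3, h4⟩
    refine Prod.ext (h1.trans h3.symm) (funext fun i => ?_)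
    have := (h2 i).trans (h4 i).symm
    exact_mod_cast this
  have hgood : ∀ c₁ c₀, S c₁ c₀ → ∀ t c₁', V₁.Fires t c₁ c₁' → ∃ t₀, Good c₁ c₀ t t₀ := by
    intro c₁ c₀ h t c₁' ht
    obtain ⟨t₀, c₀', h1, h2, h3⟩ := hS c₁ c₀ h t c₁' ht
    refine ⟨t₀, h2, ⟨c₀', h1⟩, fun d₁ d₀ hd₁ hd₀ => ?_⟩
    rwa [functional _ _ _ _ _ hd₁ ht, functional _ _ _ _ _ hd₀ h1]
  -- A memoryless strategy. The fallback transition is irrelevant: plays that follow `σ` stay inside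
  -- `S`, where a good answer to every legal move exists.
  let σ : DuplicatorStrategy V₀ V₁ := fun _ c₁ c₀ t =>
    if h : ∃ t₀, Good c₁ c₀ t t₀ then h.choose else ⟨V₀.init.1, t.letter, 0, V₀.init.1⟩
  have hσ : ∀ h c₁ c₀, S c₁ c₀ → ∀ t c₁', V₁.Fires t c₁ c₁' → Good c₁ c₀ t (σ h c₁ c₀ t) := by
    intro h c₁ c₀ hc t c₁' ht
    have := hgood c₁ c₀ hc t c₁' ht
    simp only [σ, dif_pos this]
    exact this.choose_spec
  have hplay : ∀ h c₁ c₀, IsPlay V₀ V₁ σ h c₁ c₀ → S c₁ c₀ := by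
    intro h c₁ c₀ hp
    induction hp with
    | start => exact hinit
    | round _ h1 h2 _ ih => exact (hσ [] _ _ ih _ _ h1).2.2 _ _ h1 h2
  refine ⟨σ, fun h c₁ c₀ hp t c₁' ht => ?_⟩
  have := hσ h c₁ c₀ (hplay _ _ _ hp) t c₁' ht
  exact ⟨this.1, this.2.1⟩

end VASS

/-- Rename the states of a transition. -/
def VASSTransition.relabel {k : ℕ} {Q Q' α : Type} (e : Q → Q') (t : VASSTransition k Q α) :
    VASSTransition k Q' α :=
  ⟨e t.src, t.letter, t.eff, e t.tgt⟩

namespace VASS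

variable {k : ℕ} {α : Type} [DecidableEq α]

/-- Rename the states of a VASS. -/
def relabel (V : VASS k α) {Q' : Type} [Fintype Q'] [DecidableEq Q'] (e : V.Q ≃ Q') :
    VASS k α where
  Q := Q'
  init := (e V.init.1, V.init.2)
  final := V.final.image fun c => (e c.1, c.2)
  trans := V.trans.image (VASSTransition.relabel e)

section Relabel

variable {V : VASS k α} {Q' : Type} [Fintype Q'] [DecidableEq Q'] {e : V.Q ≃ Q'}

theorem mem_trans_relabel {t : VASSTransition k Q' α} :
    t ∈ (V.relabel e).trans ↔ ∃ t' ∈ V.trans, t'.relabel e = t := Finset.mem_image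

theorem fires_relabel {t : V.Trans} {c c' : V.Config} (h : V.Fires t c c') :
    (V.relabel e).Fires (t.relabel e) (e c.1, c.2) (e c'.1, c'.2) :=
  ⟨mem_trans_relabel.2 ⟨t, h.1, rfl⟩, congrArg e h.2.1, congrArg e h.2.2.1, h.2.2.2⟩

theorem fires_of_relabel {t : (V.relabel e).Trans} {c c' : (V.relabel e).Config}
    (h : (V.relabel e).Fires t c c') :
    V.Fires (t.relabel e.symm) (e.symm c.1, c.2) (e.symm c'.1, c'.2) := by
  obtain ⟨h1, h2, h3, h4⟩ := h
  obtain ⟨t, ht, rfl⟩ := mem_trans_relabel.1 h1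
  refine ⟨?_, congrArg e.symm h2, congrArg e.symm h3, h4⟩
  simpa [VASSTransition.relabel] using ht

theorem traceLanguage_relabel : (V.relabel e).traceLanguage = V.traceLanguage := by
  ext w
  rw [mem_traceLanguage_iff, mem_traceLanguage_iff]
  constructor
  · rintro ⟨ρ, c, h, rfl⟩
    have key : ∀ c₀ ρ c, (V.relabel e).Run c₀ ρ c → ∃ ρ' c', V.Run (e.symm c₀.1, c₀.2) ρ' c' ∧
        ρ'.map VASSTransition.letter = ρ.map VASSTransition.letter := by
      intro c₀ ρ c h
      induction h with
      | nil c => exact ⟨[], _, .nil _, rfl⟩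
      | cons h1 _ ih =>
        obtain ⟨ρ', c', h2, h3⟩ := ih
        exact ⟨_, c', .cons (fires_of_relabel h1) h2, by simp [h3, VASSTransition.relabel]⟩
    simpa [relabel] using key _ _ _ h
  · rintro ⟨ρ, c, h, rfl⟩
    have key : ∀ c₀ ρ c, V.Run c₀ ρ c → ∃ ρ' c', (V.relabel e).Run (e c₀.1, c₀.2) ρ' c' ∧
        ρ'.map VASSTransition.letter = ρ.map VASSTransition.letter := by
      intro c₀ ρ c h
      induction h with
      | nil c => exact ⟨[], _, .nil _, rfl⟩
      | cons h1 _ ih =>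
        obtain ⟨ρ', c', h2, h3⟩ := ih
        exact ⟨_, c', .cons (fires_relabel h1) h2, by simp [h3, VASSTransition.relabel]⟩
    exact key _ _ _ h

theorem deterministic_relabel (h : V.Deterministic) : (V.relabel e).Deterministic := by
  intro t ht t' ht' h1 h2
  obtain ⟨t, h3, rfl⟩ := mem_trans_relabel.1 ht
  obtain ⟨t', h4, rfl⟩ := mem_trans_relabel.1 ht'
  rw [h t h3 t' h4 (e.injective h1) h2]

/-- Pulling configurations back along the renamings lets the game be analysed on the original,
structured states. -/
theorem simulates_relabel {V₀ : VASS k α} {Q₀ : Type} [Fintype Q₀] [DecidableEq Q₀]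
    {e₀ : V₀.Q ≃ Q₀} (S : V.Config → V₀.Config → Prop) (hinit : S V.init V₀.init)
    (hS : ∀ c₁ c₀, S c₁ c₀ → ∀ t c₁', V.Fires t c₁ c₁' →
      ∃ t₀ c₀', V₀.Fires t₀ c₀ c₀' ∧ t₀.letter = t.letter ∧ S c₁' c₀') :
    (V₀.relabel e₀).Simulates (V.relabel e) := by
  refine simulates_of_relation (fun c₁ c₀ => S (e.symm c₁.1, c₁.2) (e₀.symm c₀.1, c₀.2)) ?_ ?_
  · simpa [relabel] using hinit
  · intro c₁ c₀ h t c₁' ht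
    obtain ⟨t₀, c₀', h1, h2, h3⟩ := hS _ _ h _ _ (fires_of_relabel ht)
    refine ⟨t₀.relabel e₀, (e₀ c₀'.1, c₀'.2), ?_, h2, by simpa using h3⟩
    have h4 : ((e₀ (e₀.symm c₀.1), c₀.2) : (V₀.relabel e₀).Config) = c₀ :=
      Prod.ext (e₀.apply_symm_apply c₀.1) rfl
    exact h4 ▸ fires_relabel h1

end Relabel

/-- The VASSs that differ from a given one only in the initial counters have descriptions that
differ only there. -/
theorem exists_code_relabel {m n : ℕ} {Q : Type} [Fintype Q] (e : Q ≃ Fin (n + 1)) (q : Q)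
    (T : Finset (VASSTransition k Q (Fin m))) :
    ∃ L : List (ℕ × Fin m × (Fin k → ℤ) × ℕ), ∀ u : Fin k → ℕ,
      Code.toVASS (n, ((e q : ℕ), u), [], L) =
        relabel { Q := Q, init := (q, u), final := ∅, trans := T } e := by
  refine ⟨(T.image (VASSTransition.relabel e)).toList.map fun t =>
    ((t.src : ℕ), t.letter, t.eff, (t.tgt : ℕ)), fun u => ?_⟩
  simp only [Code.toVASS, relabel, List.map_map, Function.comp_def, Fin.ofNat_eq_cast,
    Fin.cast_val_eq_self, List.map_id', Finset.toList_toFinset, List.map_nil, List.toFinset_nil,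
    Finset.image_empty]

end VASS

/-! ### Machines with a finite set of states -/

namespace VectorMachine

variable {k : ℕ} {Q : Type}

/-- One step of the machine with the table `T`. In the state `q` with `T q = some (v, r, r')`, the
machine adds `v` and goes to `r`, or, if `v` cannot be added, it goes to `r'`. In the state `q` with
`T q = none` it has halted. -/
def tableStep (T : Q → Option ((Fin k → ℤ) × Q × Q)) (c : Q × (Fin k → ℕ)) : Q × (Fin k → ℕ) :=
  match T c.1 with
  | none => c
  | some (v, r, r') => if Fireable v c.2 then (r, shift v c.2) else (r', c.2)

/-- The machine with the table `T` halts from `c`. -/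
def TableHalts (T : Q → Option ((Fin k → ℤ) × Q × Q)) (c : Q × (Fin k → ℕ)) : Prop :=
  ∃ n, T ((tableStep T)^[n] c).1 = none

/-- All addresses beyond the end of the instruction list become one state. -/
def clampAddress (n r : ℕ) : Fin (n + 1) := ⟨min r n, by omega⟩

/-- The table of a list of instructions. -/
def table (M : List (Instr k)) (q : Fin (M.length + 1)) :
    Option ((Fin k → ℤ) × Fin (M.length + 1) × Fin (M.length + 1)) :=
  M[(q : ℕ)]?.map fun x => (x.1, clampAddress M.length x.2.1, clampAddress M.length x.2.2)

theorem getElem?_clampAddress (M : List (Instr k)) (r : ℕ) :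
    M[(clampAddress M.length r : ℕ)]? = M[r]? := by
  rcases le_total r M.length with h | h
  · simp [clampAddress, h]
  · simp [clampAddress, h]

/-- Clamping addresses commutes with steps, because all addresses beyond the end behave alike. -/
theorem tableHalts_iff (M : List (Instr k)) (c : ℕ × (Fin k → ℕ)) :
    TableHalts (table M) (clampAddress M.length c.1, c.2) ↔ Halts M c := by
  have h : Function.Semiconj (fun c : ℕ × (Fin k → ℕ) => (clampAddress M.length c.1, c.2))
      (step M) (tableStep (table M)) := by
    intro c
    simp only [step, tableStep, table, getElem?_clampAddress]
    rcases M[c.1]? with _ | ⟨v, r, r'⟩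
    · rfl
    · simp only [Option.map_some]
      split_ifs <;> rfl
  refine exists_congr fun n => ?_
  rw [← (h.iterate_right n) c]
  simp [table, getElem?_clampAddress]

variable {α : Type} [Fintype Q] [DecidableEq Q] [DecidableEq α]

/-! ### The deterministic VASS of a machine -/

/-- The transitions of the deterministic VASS of a machine. The letter `a` stands for the addition
of the vector, and the letter `b` for the claim that it cannot be added, which is not checked. In
halting states, only the letter `a` can be read. -/
def claimTrans (T : Q → Option ((Fin k → ℤ) × Q × Q)) (a b : α) :
    Finset (VASSTransition k Q α) :=
  Finset.univ.biUnion fun q => match T q with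
    | none => {⟨q, a, 0, q⟩}
    | some (v, r, r') => {⟨q, a, v, r⟩, ⟨q, b, 0, r'⟩}

/-- The states of the VASS that refutes wrong claims: those of a copy of the machine where all
claims have been right so far, and of a copy where a wrong claim has been found. Between them are
the pending states, one for each instruction: the vector of the instruction has been added in order
to refute the claim that this is impossible, and has yet to be taken back. -/
abbrev RefuteState (Q : Type) : Type := Q ⊕ Q ⊕ Q

/-- The state `q` with only right claims so far. -/
abbrev honest (q : Q) : RefuteState Q := .inl q

/-- The state `q` after a wrong claim. -/
abbrev full (q : Q) : RefuteState Q := .inr (.inl q)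

/-- The state in which the vector of the instruction of `q` has yet to be taken back. -/
abbrev pending (q : Q) : RefuteState Q := .inr (.inr q)

/-- The transitions of the nondeterministic VASS of a machine. It can read `a` in halting states
only after a wrong claim. -/
def refuteTrans (T : Q → Option ((Fin k → ℤ) × Q × Q)) (a b : α) :
    Finset (VASSTransition k (RefuteState Q) α) :=
  Finset.univ.biUnion fun q => match T q with
    | none => {⟨full q, a, 0, full q⟩}
    | some (v, r, r') => {⟨honest q, a, v, honest r⟩, ⟨honest q, b, 0, honest r'⟩,
        ⟨honest q, b, v, pending q⟩, ⟨full q, a, v, full r⟩, ⟨full q, b, 0, full r'⟩} ∪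
      match T r' with
      | none => {⟨pending q, a, -v, full r'⟩}
      | some (w, s, s') => {⟨pending q, a, w - v, full s⟩, ⟨pending q, b, -v, full s'⟩}

section Trans

variable {T : Q → Option ((Fin k → ℤ) × Q × Q)} {a b : α}

theorem mem_claimTrans {t : VASSTransition k Q α} :
    t ∈ claimTrans T a b ↔ (T t.src = none ∧ t = ⟨t.src, a, 0, t.src⟩) ∨
      ∃ v r r', T t.src = some (v, r, r') ∧ (t = ⟨t.src, a, v, r⟩ ∨ t = ⟨t.src, b, 0, r'⟩) := by
  simp only [claimTrans, Finset.mem_biUnion, Finset.mem_univ, true_and]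
  constructor
  · rintro ⟨q, hq⟩
    rcases hT : T q with _ | ⟨v, r, r'⟩
    · simp only [hT, Finset.mem_singleton] at hq
      subst hq
      exact Or.inl ⟨hT, rfl⟩
    · simp only [hT, Finset.mem_insert, Finset.mem_singleton] at hq
      rcases hq with rfl | rfl
      · exact Or.inr ⟨v, r, r', hT, Or.inl rfl⟩
      · exact Or.inr ⟨v, r, r', hT, Or.inr rfl⟩
  · rintro (⟨hT, ht⟩ | ⟨v, r, r', hT, ht⟩) <;> refine ⟨t.src, ?_⟩ <;> simp only [hT]
    · exact Finset.mem_singleton.2 ht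
    · simpa using ht

theorem mem_claimTrans_halt {q : Q} (h : T q = none) : ⟨q, a, 0, q⟩ ∈ claimTrans T a b :=
  mem_claimTrans.2 (Or.inl ⟨h, rfl⟩)

theorem mem_claimTrans_fire {q r r' : Q} {v : Fin k → ℤ} (h : T q = some (v, r, r')) :
    ⟨q, a, v, r⟩ ∈ claimTrans T a b :=
  mem_claimTrans.2 (Or.inr ⟨v, r, r', h, Or.inl rfl⟩)

theorem mem_claimTrans_claim {q r r' : Q} {v : Fin k → ℤ} (h : T q = some (v, r, r')) :
    ⟨q, b, 0, r'⟩ ∈ claimTrans T a b :=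
  mem_claimTrans.2 (Or.inr ⟨v, r, r', h, Or.inr rfl⟩)

theorem mem_refuteTrans_honest {q : Q} {t : VASSTransition k (RefuteState Q) α}
    (hq : t.src = honest q) :
    t ∈ refuteTrans T a b ↔ ∃ v r r', T q = some (v, r, r') ∧ (t = ⟨honest q, a, v, honest r⟩ ∨
      t = ⟨honest q, b, 0, honest r'⟩ ∨ t = ⟨honest q, b, v, pending q⟩) := by
  obtain ⟨src, l, v, tgt⟩ := t
  subst hq
  simp only [refuteTrans, Finset.mem_biUnion, Finset.mem_univ, true_and]
  constructor
  · rintro ⟨p, hp⟩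
    rcases hT : T p with _ | ⟨v, r, r'⟩
    · simp [hT] at hp
    · rcases hT' : T r' with _ | ⟨w, s, s'⟩ <;>
      · simp [hT, hT'] at hp
        have hpq : q = p := by tauto
        subst hpq
        refine ⟨v, r, r', hT, ?_⟩
        simpa using hp
  · rintro ⟨v, r, r', hT, ht⟩
    refine ⟨q, ?_⟩
    simp only [hT, Finset.mem_union, Finset.mem_insert]
    tauto

theorem mem_refuteTrans_full {q : Q} {t : VASSTransition k (RefuteState Q) α}
    (hq : t.src = full q) :
    t ∈ refuteTrans T a b ↔ (T q = none ∧ t = ⟨full q, a, 0, full q⟩) ∨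
      ∃ v r r', T q = some (v, r, r') ∧ (t = ⟨full q, a, v, full r⟩ ∨
        t = ⟨full q, b, 0, full r'⟩) := by
  obtain ⟨src, l, v, tgt⟩ := t
  subst hq
  simp only [refuteTrans, Finset.mem_biUnion, Finset.mem_univ, true_and]
  constructor
  · rintro ⟨p, hp⟩
    rcases hT : T p with _ | ⟨v, r, r'⟩
    · simp [hT] at hp
      obtain ⟨rfl, h⟩ := hp
      left
      simpa [hT] using h
    · rcases hT' : T r' with _ | ⟨w, s, s'⟩ <;>
      · simp [hT, hT'] at hp
        have hpq : q = p := by tauto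
        subst hpq
        refine Or.inr ⟨v, r, r', hT, ?_⟩
        simpa using hp
  · rintro (⟨hT, ht⟩ | ⟨v, r, r', hT, ht⟩) <;> refine ⟨q, ?_⟩
    · simp only [hT, Finset.mem_singleton]
      exact ht
    · simp only [hT, Finset.mem_union, Finset.mem_insert, Finset.mem_singleton]
      tauto

theorem mem_refuteTrans_pending {q : Q} {t : VASSTransition k (RefuteState Q) α}
    (hq : t.src = pending q) :
    t ∈ refuteTrans T a b ↔ ∃ v r r', T q = some (v, r, r') ∧
      ((T r' = none ∧ t = ⟨pending q, a, -v, full r'⟩) ∨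
      ∃ w s s', T r' = some (w, s, s') ∧ (t = ⟨pending q, a, w - v, full s⟩ ∨
        t = ⟨pending q, b, -v, full s'⟩)) := by
  obtain ⟨src, l, x, tgt⟩ := t
  subst hq
  simp only [refuteTrans, Finset.mem_biUnion, Finset.mem_univ, true_and]
  constructor
  · rintro ⟨p, hp⟩
    rcases hT : T p with _ | ⟨v, r, r'⟩
    · simp [hT] at hp
    · rcases hT' : T r' with _ | ⟨w, s, s'⟩
      · simp [hT, hT'] at hp
        obtain ⟨rfl, h⟩ := hp
        refine ⟨v, r, r', hT, Or.inl ⟨hT', ?_⟩⟩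
        simpa using h
      · simp [hT, hT'] at hp
        have hpq : q = p := by tauto
        subst hpq
        refine ⟨v, r, r', hT, Or.inr ⟨w, s, s', hT', ?_⟩⟩
        simpa using hp
  · rintro ⟨v, r, r', hT, (⟨hT', ht⟩ | ⟨w, s, s', hT', ht⟩)⟩ <;> refine ⟨q, ?_⟩ <;>
    · simp only [hT, hT', Finset.mem_union, Finset.mem_insert, Finset.mem_singleton]
      tauto

end Trans

/-- The deterministic VASS of a machine. -/
def claimVASS (T : Q → Option ((Fin k → ℤ) × Q × Q)) (a b : α) (c : Q × (Fin k → ℕ)) :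
    VASS k α where
  Q := Q
  init := c
  final := ∅
  trans := claimTrans T a b

/-- The nondeterministic VASS of a machine. -/
def refuteVASS (T : Q → Option ((Fin k → ℤ) × Q × Q)) (a b : α) (c : Q × (Fin k → ℕ)) :
    VASS k α where
  Q := RefuteState Q
  init := (honest c.1, c.2)
  final := ∅
  trans := refuteTrans T a b

theorem claimVASS_deterministic (T : Q → Option ((Fin k → ℤ) × Q × Q)) {a b : α} (hab : a ≠ b)
    (c : Q × (Fin k → ℕ)) : (claimVASS T a b c).Deterministic := by
  rintro ⟨q, l, v, r⟩ ht ⟨q', l', v', r'⟩ ht' (rfl : q = q') (rfl : l = l')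
  have h1 := mem_claimTrans.1 ht
  have h2 := mem_claimTrans.1 ht'
  rcases hT : T q with _ | ⟨w, s, s'⟩ <;> simp [hT] at h1 h2 <;> grind

/-! ### The two simulations and the separating word -/

section Simulation

variable {T : Q → Option ((Fin k → ℤ) × Q × Q)} {a b : α} {c₀ : Q × (Fin k → ℕ)}

/-- The configurations of the two VASSs that belong to each other. -/
def Matches (T : Q → Option ((Fin k → ℤ) × Q × Q)) (H : Q × (Fin k → ℕ) → Prop)
    (c : Q × (Fin k → ℕ)) (d : RefuteState Q × (Fin k → ℕ)) : Prop :=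
  (d = (honest c.1, c.2) ∧ H c) ∨ d = (full c.1, c.2) ∨
    ∃ q v r, T q = some (v, r, c.1) ∧ d.1 = pending q ∧ ∀ i, (d.2 i : ℤ) = c.2 i + v i

/-- A refutation is answered by the plain claim. The counters then differ by the vector `v` until
the next transition subtracts it, so they agree again afterwards; this needs no assumption on
halting. -/
theorem claimVASS_answers {c : Q × (Fin k → ℕ)} {d : RefuteState Q × (Fin k → ℕ)}
    (h : Matches T (fun _ => True) c d) {t : VASSTransition k (RefuteState Q) α}
    {d' : RefuteState Q × (Fin k → ℕ)} (ht : (refuteVASS T a b c₀).Fires t d d') :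
    ∃ t₀ c', (claimVASS T a b c₀).Fires t₀ c c' ∧ t₀.letter = t.letter ∧
      Matches T (fun _ => True) c' d' := by
  obtain ⟨q, u⟩ := c
  obtain ⟨x, y⟩ := d
  obtain ⟨x', y'⟩ := d'
  obtain ⟨ht, h1, h2, h3⟩ := ht
  simp only at h1 h2 h3
  change t ∈ refuteTrans T a b at ht
  rcases h with ⟨h, -⟩ | h | ⟨p, v, r, hp, h4, h5⟩
  · simp only [Prod.mk.injEq] at h
    obtain ⟨rfl, rfl⟩ := h
    obtain ⟨v, r, r', hT, rfl | rfl | rfl⟩ := (mem_refuteTrans_honest h1.symm).1 ht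
    · refine ⟨⟨q, a, v, r⟩, (r, y'), ⟨mem_claimTrans_fire hT, rfl, rfl, h3⟩, rfl, ?_⟩
      exact Or.inl ⟨Prod.ext h2 rfl, trivial⟩
    · refine ⟨⟨q, b, 0, r'⟩, (r', y'), ⟨mem_claimTrans_claim hT, rfl, rfl, h3⟩, rfl, ?_⟩
      exact Or.inl ⟨Prod.ext h2 rfl, trivial⟩
    · refine ⟨⟨q, b, 0, r'⟩, (r', y), ⟨mem_claimTrans_claim hT, rfl, rfl, by simp⟩, rfl, ?_⟩
      exact Or.inr (Or.inr ⟨q, v, r, hT, h2, h3⟩)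
  · simp only [Prod.mk.injEq] at h
    obtain ⟨rfl, rfl⟩ := h
    obtain ⟨hT, rfl⟩ | ⟨v, r, r', hT, rfl | rfl⟩ := (mem_refuteTrans_full h1.symm).1 ht
    · refine ⟨⟨q, a, 0, q⟩, (q, y'), ⟨mem_claimTrans_halt hT, rfl, rfl, h3⟩, rfl, ?_⟩
      exact Or.inr (Or.inl (Prod.ext h2 rfl))
    · refine ⟨⟨q, a, v, r⟩, (r, y'), ⟨mem_claimTrans_fire hT, rfl, rfl, h3⟩, rfl, ?_⟩
      exact Or.inr (Or.inl (Prod.ext h2 rfl))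
    · refine ⟨⟨q, b, 0, r'⟩, (r', y'), ⟨mem_claimTrans_claim hT, rfl, rfl, h3⟩, rfl, ?_⟩
      exact Or.inr (Or.inl (Prod.ext h2 rfl))
  · simp only at h4 h5 hp
    subst h4
    obtain ⟨v', r₁, r', hT, h6⟩ := (mem_refuteTrans_pending h1.symm).1 ht
    rw [hp] at hT
    simp only [Option.some.injEq, Prod.mk.injEq] at hT
    obtain ⟨rfl, rfl, rfl⟩ := hT
    obtain ⟨hT, rfl⟩ | ⟨w, s, s', hT, rfl | rfl⟩ := h6
    · refine ⟨⟨q, a, 0, q⟩, (q, y'), ⟨mem_claimTrans_halt hT, rfl, rfl, fun i => ?_⟩,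
        rfl, Or.inr (Or.inl (Prod.ext h2 rfl))⟩
      simp [h3, h5]
    · refine ⟨⟨q, a, w, s⟩, (s, y'), ⟨mem_claimTrans_fire hT, rfl, rfl, fun i => ?_⟩,
        rfl, Or.inr (Or.inl (Prod.ext h2 rfl))⟩
      simp [h3, h5]
    · refine ⟨⟨q, b, 0, s'⟩, (s', y'), ⟨mem_claimTrans_claim hT, rfl, rfl, fun i => ?_⟩,
        rfl, Or.inr (Or.inl (Prod.ext h2 rfl))⟩
      simp [h3, h5]

theorem fires_refute_full {q : Q} {u : Fin k → ℕ} {t : VASSTransition k Q α}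
    {c' : Q × (Fin k → ℕ)} (ht : (claimVASS T a b c₀).Fires t (q, u) c') :
    (refuteVASS T a b c₀).Fires (t.relabel full) (full q, u) (full c'.1, c'.2) := by
  obtain ⟨ht, h1, h2, h3⟩ := ht
  refine ⟨?_, congrArg full h1, congrArg full h2, h3⟩
  change t ∈ claimTrans T a b at ht
  refine (mem_refuteTrans_full (q := t.src) rfl).2 ?_
  obtain ⟨hT, ht⟩ | ⟨v, r, r', hT, ht | ht⟩ := mem_claimTrans.1 ht
  · exact Or.inl ⟨hT, by rw [ht]; rfl⟩
  · exact Or.inr ⟨v, r, r', hT, Or.inl (by rw [ht]; rfl)⟩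
  · exact Or.inr ⟨v, r, r', hT, Or.inr (by rw [ht]; rfl)⟩

/-- The only moves that the honest copy cannot copy are the `a`-loops of halting states, and the
invariant `H` excludes these. It is applied with `H` saying that the machine does not halt. -/
theorem refuteVASS_answers {H : Q × (Fin k → ℕ) → Prop} (hH : ∀ c, H c → T c.1 ≠ none)
    (hstep : ∀ c, H c → H (tableStep T c)) {c : Q × (Fin k → ℕ)}
    {d : RefuteState Q × (Fin k → ℕ)} (h : Matches T H c d) {t : VASSTransition k Q α}
    {c' : Q × (Fin k → ℕ)} (ht : (claimVASS T a b c₀).Fires t c c') :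
    ∃ t₀ d', (refuteVASS T a b c₀).Fires t₀ d d' ∧ t₀.letter = t.letter ∧
      Matches T H c' d' := by
  obtain ⟨q, u⟩ := c
  obtain ⟨x, y⟩ := d
  obtain ⟨q', u'⟩ := c'
  rcases h with ⟨h, hc⟩ | h | ⟨p, v, r, hp, h4, h5⟩
  · obtain ⟨ht, h1, h2, h3⟩ := ht
    simp only [Prod.mk.injEq] at h h1 h2 h3
    obtain ⟨rfl, rfl⟩ := h
    change t ∈ claimTrans T a b at ht
    have h4 := hH _ hc
    have h5 := hstep _ hc
    obtain ⟨hT, ht⟩ | ⟨v, r, r', hT, ht | ht⟩ := mem_claimTrans.1 ht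
    · exact absurd hT (h1 ▸ h4)
    all_goals
      rw [← h1] at ht hT
      subst ht
      simp only at h2 h3 ⊢
      subst h2
      simp only [tableStep, hT] at h5
    -- An `a` cannot be a lie: the counters themselves guarantee that the machine takes this branch
    -- too.
    · have hf : Fireable v y := fun i => by rw [← h3 i]; positivity
      have hs : shift v y = u' := funext fun i => by
        exact_mod_cast (coe_shift hf i).trans (h3 i).symm
      rw [if_pos hf, hs] at h5
      exact ⟨⟨honest q, a, v, honest q'⟩, (honest q', u'),
        ⟨(mem_refuteTrans_honest rfl).2 ⟨v, q', r', hT, Or.inl rfl⟩, rfl, rfl, h3⟩, rfl,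
        Or.inl ⟨rfl, h5⟩⟩
    · have hu : u' = y := funext fun i => by simpa using h3 i
      subst hu
      -- If the vector can be added, the claim is wrong and is refuted; if not, the claim is the
      -- machine's own step and the honest copy follows it.
      by_cases hf : Fireable v u'
      · refine ⟨⟨honest q, b, v, pending q⟩, (pending q, shift v u'),
          ⟨(mem_refuteTrans_honest rfl).2 ⟨v, r, q', hT, Or.inr (Or.inr rfl)⟩, rfl, rfl,
            coe_shift hf⟩, rfl, Or.inr (Or.inr ⟨q, v, r, hT, rfl, coe_shift hf⟩)⟩
      · rw [if_neg hf] at h5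
        exact ⟨⟨honest q, b, 0, honest q'⟩, (honest q', u'),
          ⟨(mem_refuteTrans_honest rfl).2 ⟨v, r, q', hT, Or.inr (Or.inl rfl)⟩, rfl, rfl, h3⟩, rfl,
          Or.inl ⟨rfl, h5⟩⟩
  · simp only [Prod.mk.injEq] at h
    obtain ⟨rfl, rfl⟩ := h
    exact ⟨t.relabel full, _, fires_refute_full ht, rfl, Or.inr (Or.inl rfl)⟩
  · obtain ⟨ht, h1, h2, h3⟩ := ht
    simp only at h1 h2 h3 h4 h5 hp
    subst h4
    change t ∈ claimTrans T a b at ht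
    obtain ⟨hT, ht⟩ | ⟨w, s, s', hT, ht | ht⟩ := mem_claimTrans.1 ht
    all_goals
      rw [← h1] at ht hT
      subst ht
      simp only at h2 h3 ⊢
      subst h2
    · exact ⟨⟨pending p, a, -v, full q'⟩, (full q', u'), ⟨(mem_refuteTrans_pending rfl).2
        ⟨v, r, q', hp, Or.inl ⟨hT, rfl⟩⟩, rfl, rfl, fun i => by simp [h3, h5]⟩, rfl,
        Or.inr (Or.inl rfl)⟩
    · exact ⟨⟨pending p, a, w - v, full q'⟩, (full q', u'), ⟨(mem_refuteTrans_pending rfl).2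
        ⟨v, r, q, hp, Or.inr ⟨w, q', s', hT, Or.inl rfl⟩⟩, rfl, rfl, fun i => by simp [h3, h5]⟩,
        rfl, Or.inr (Or.inl rfl)⟩
    · exact ⟨⟨pending p, b, -v, full q'⟩, (full q', u'), ⟨(mem_refuteTrans_pending rfl).2
        ⟨v, r, q, hp, Or.inr ⟨w, s, q', hT, Or.inr rfl⟩⟩, rfl, rfl, fun i => by simp [h3, h5]⟩,
        rfl, Or.inr (Or.inl rfl)⟩

/-- The word that is read along the computation of the machine, with at most `n` steps before the
halting state. -/
def computationWord (T : Q → Option ((Fin k → ℤ) × Q × Q)) (a b : α) :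
    ℕ → Q × (Fin k → ℕ) → List α
  | 0, _ => [a]
  | n + 1, c => match T c.1 with
    | none => [a]
    | some (v, _, _) => (if Fireable v c.2 then a else b) :: computationWord T a b n (tableStep T c)

theorem exists_run_claimVASS {n : ℕ} {c : Q × (Fin k → ℕ)}
    (h : T ((tableStep T)^[n] c).1 = none) :
    ∃ ρ c', (claimVASS T a b c₀).Run c ρ c' ∧
      ρ.map VASSTransition.letter = computationWord T a b n c := by
  have halted : ∀ c : Q × (Fin k → ℕ), T c.1 = none →
      (claimVASS T a b c₀).Run c [⟨c.1, a, 0, c.1⟩] c := fun c hc =>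
    .cons (c' := c) ⟨mem_claimTrans_halt hc, rfl, rfl, by simp⟩ (.nil _)
  induction n generalizing c with
  | zero => exact ⟨_, c, halted c h, rfl⟩
  | succ n ih =>
    obtain ⟨ρ, c', h1, h2⟩ := ih h
    rcases hT : T c.1 with _ | ⟨v, r, r'⟩
    · exact ⟨_, c, halted c hT, by simp [computationWord, hT]⟩
    · simp only [computationWord, hT, ← h2]
      by_cases hf : Fireable v c.2
      · refine ⟨⟨c.1, a, v, r⟩ :: ρ, c', .cons (c' := tableStep T c)
          ⟨mem_claimTrans_fire hT, rfl, ?_, ?_⟩ h1,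
          by simp [hf]⟩
        · simp [tableStep, hT, hf]
          rfl
        · simpa [tableStep, hT, hf] using coe_shift hf
      · refine ⟨⟨c.1, b, 0, r'⟩ :: ρ, c', .cons (c' := tableStep T c)
          ⟨mem_claimTrans_claim hT, rfl, ?_, ?_⟩ h1,
          by simp [hf]⟩
        · simp [tableStep, hT, hf]
          rfl
        · simp [tableStep, hT, hf]

/-- Along the true computation every `b` is a correct claim, so no transition to a pending state can
be fired. The run stays honest and cannot read the final `a`. -/
theorem not_run_refuteVASS (hab : a ≠ b) {n : ℕ} {c : Q × (Fin k → ℕ)}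
    (h : T ((tableStep T)^[n] c).1 = none) {ρ : List (VASSTransition k (RefuteState Q) α)}
    {d : RefuteState Q × (Fin k → ℕ)} (hrun : (refuteVASS T a b c₀).Run (honest c.1, c.2) ρ d) :
    ρ.map VASSTransition.letter ≠ computationWord T a b n c := by
  induction n generalizing c ρ d with
  | zero =>
    intro hw
    cases hrun with
    | nil => exact List.cons_ne_nil _ _ hw.symm
    | cons hf _ =>
      obtain ⟨v, r, r', hT, -⟩ := (mem_refuteTrans_honest hf.2.1.symm).1 hf.1
      simp only [Function.iterate_zero, id] at h
      simp [hT] at h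
  | succ n ih =>
    intro hw
    cases hrun with
    | nil =>
      rcases hT : T c.1 with _ | ⟨v, r, r'⟩ <;> simp only [computationWord, hT] at hw <;>
        exact List.cons_ne_nil _ _ hw.symm
    | @cons _ d' _ t _ hf hr =>
      obtain ⟨v, r, r', hT, ht⟩ := (mem_refuteTrans_honest hf.2.1.symm).1 hf.1
      simp only [computationWord, hT] at hw
      obtain ⟨hw1, hw2⟩ := List.cons.inj hw
      obtain ⟨-, -, h2, h3⟩ := hf
      obtain ⟨x, y⟩ := d'
      simp only at h2 h3
      have hstep : x = honest (tableStep T c).1 ∧ y = (tableStep T c).2 := by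
        rcases ht with rfl | rfl | rfl
        · have hfire : Fireable v c.2 := fun i => by
            have := h3 i
            simp only at this
            omega
          refine ⟨by simpa [tableStep, hT, hfire] using h2, funext fun i => ?_⟩
          have := (h3 i).trans (coe_shift hfire i).symm
          simpa [tableStep, hT, hfire] using this
        · have hfire : ¬ Fireable v c.2 := fun hfire => hab (by simpa [hfire] using hw1.symm)
          refine ⟨by simpa [tableStep, hT, hfire] using h2, funext fun i => ?_⟩
          simpa [tableStep, hT, hfire] using h3 i
        · have hfire : Fireable v c.2 := fun i => by
            have := h3 i
            simp only at this
            omega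
          exact absurd (by simpa [hfire] using hw1.symm) hab
      obtain ⟨rfl, rfl⟩ := hstep
      exact ih h hr hw2

end Simulation

/-- Only the exponent varies; the two primes are constants, so no algorithm that enumerates primes
is needed. -/
theorem computable_initial_counters : Computable fun c : Nat.Partrec.Code =>
    (![prime 2 * prime 0 ^ Encodable.encode c, 0] : Fin 2 → ℕ) := by
  have hpow : Primrec fun n : ℕ => prime 0 ^ n :=
    (Primrec.nat_rec₁ 1 (f := fun _ x => x * prime 0)
      (Primrec.nat_mul.comp₂ Primrec₂.right (Primrec₂.const (prime 0)))).of_eq fun n => by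
        induction n with
        | zero => rfl
        | succ n ih => rw [pow_succ, ← ih]
  have h : Primrec fun c : Nat.Partrec.Code => prime 2 * prime 0 ^ Encodable.encode c :=
    Primrec.nat_mul.comp (Primrec.const _) (hpow.comp Primrec.encode)
  refine Primrec.to_comp (Primrec.fin_curry.2 ?_)
  have h2 : Primrec₂ fun (c : Nat.Partrec.Code) (i : Fin 2) =>
      if i = 0 then prime 2 * prime 0 ^ Encodable.encode c else 0 :=
    Primrec.ite (Primrec.eq.comp Primrec.snd (Primrec.const 0)) (h.comp Primrec.fst)
      (Primrec.const 0)
  refine h2.of_eq fun c i => ?_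
  fin_cases i <;> rfl

/-- The two VASSs of a machine are in two-sided simulation if the machine does not halt, and have
different trace languages if it halts. Both depend on the initial counters only through the initial
configuration. -/
theorem exists_codes {k m : ℕ} (hm : 2 ≤ m) (M : List (Instr k)) :
    ∃ (n₁ q₁ n₂ q₂ : ℕ) (L₁ L₂ : List (ℕ × Fin m × (Fin k → ℤ) × ℕ)), ∀ u : Fin k → ℕ,
      (VASS.Code.toVASS (n₁, (q₁, u), [], L₁)).Deterministic ∧
      (Halts M (0, u) → (VASS.Code.toVASS (n₁, (q₁, u), [], L₁)).traceLanguage ≠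
        (VASS.Code.toVASS (n₂, (q₂, u), [], L₂)).traceLanguage) ∧
      (¬ Halts M (0, u) → (VASS.Code.toVASS (n₁, (q₁, u), [], L₁)).TwoSidedSim
        (VASS.Code.toVASS (n₂, (q₂, u), [], L₂))) := by
  set a : Fin m := ⟨0, by omega⟩
  set b : Fin m := ⟨1, by omega⟩
  have hab : a ≠ b := by simp [a, b]
  set q₀ := clampAddress M.length 0
  obtain ⟨n, hn⟩ : ∃ n, Fintype.card (RefuteState (Fin (M.length + 1))) = n + 1 :=
    Nat.exists_eq_succ_of_ne_zero Fintype.card_ne_zero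
  set e := Fintype.equivFinOfCardEq hn
  obtain ⟨L₁, h₁⟩ := VASS.exists_code_relabel (Equiv.refl _) q₀ (claimTrans (table M) a b)
  obtain ⟨L₂, h₂⟩ := VASS.exists_code_relabel e (honest q₀) (refuteTrans (table M) a b)
  refine ⟨M.length, (Equiv.refl _ q₀ : Fin (M.length + 1)), n, e (honest q₀), L₁, L₂, fun u => ?_⟩
  rw [h₁, h₂, ← tableHalts_iff M (0, u)]
  refine ⟨VASS.deterministic_relabel (claimVASS_deterministic (table M) hab (q₀, u)), ?_, ?_⟩
  · rintro ⟨j, hj⟩ heq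
    have h3 := (VASS.traceLanguage_relabel (V := claimVASS (table M) a b (q₀, u))).symm.trans
      (heq.trans (VASS.traceLanguage_relabel (V := refuteVASS (table M) a b (q₀, u))))
    obtain ⟨ρ, c', h4, h5⟩ := exists_run_claimVASS (a := a) (b := b) (c₀ := (q₀, u)) hj
    have h6 : computationWord (table M) a b j (q₀, u) ∈
        (claimVASS (table M) a b (q₀, u)).traceLanguage :=
      (VASS.mem_traceLanguage_iff _ _).2 ⟨ρ, c', h4, h5⟩
    rw [h3] at h6
    obtain ⟨ρ', d, h7, h8⟩ := (VASS.mem_traceLanguage_iff _ _).1 h6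
    exact not_run_refuteVASS hab hj h7 h8
  · intro hH
    constructor
    · exact VASS.simulates_relabel (V := refuteVASS (table M) a b (q₀, u))
        (V₀ := claimVASS (table M) a b (q₀, u)) (fun d c => Matches (table M) (fun _ => True) c d)
        (Or.inl ⟨rfl, trivial⟩) (fun d c h t d' ht => claimVASS_answers h ht)
    · refine VASS.simulates_relabel
        (V := claimVASS (table M) a b (q₀, u)) (V₀ := refuteVASS (table M) a b (q₀, u))
        (Matches (table M) fun c => ¬ TableHalts (table M) c)
        (Or.inl ⟨rfl, hH⟩) (fun c d h t c' ht =>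
          refuteVASS_answers (Q := Fin (M.length + 1)) ?_ ?_ h ht)
      · exact fun c hc h0 => hc ⟨0, h0⟩
      · exact fun c hc ⟨i, hi⟩ => hc ⟨i + 1, hi⟩

end VectorMachine

theorem corollary8 (m : ℕ) (hm : 2 ≤ m)
    (R : VASS 2 (Fin m) → VASS 2 (Fin m) → Prop) (hR : Equivalence R)
    (hsim : ∀ A B : VASS 2 (Fin m), A.TwoSidedSim B → R A B)
    (hlang : ∀ A B : VASS 2 (Fin m), A.traceLanguage ≠ B.traceLanguage → ¬ R A B) :
    ¬ DecidableUnderPromise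
        (fun p : VASS.Code 2 m × VASS.Code 2 m => (VASS.Code.toVASS p.1).Deterministic)
        (fun p : VASS.Code 2 m × VASS.Code 2 m => R (VASS.Code.toVASS p.1) (VASS.Code.toVASS p.2)) := by

  rintro ⟨f, hf, hdec⟩
  obtain ⟨M, hM⟩ := VectorMachine.exists_universal_machine
  obtain ⟨n₁, q₁, n₂, q₂, L₁, L₂, hL⟩ := VectorMachine.exists_codes hm M
  set u : Nat.Partrec.Code → Fin 2 → ℕ := fun c =>
    ![VectorMachine.prime 2 * VectorMachine.prime 0 ^ Encodable.encode c, 0] with hu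
  -- The state numbers and transition lists are fixed; the program `c` enters the descriptions
  -- through the initial counters only.
  have hcomp : ∀ (n q : ℕ) (L : List (ℕ × Fin m × (Fin 2 → ℤ) × ℕ)),
      Computable fun c => ((n, (q, u c), [], L) : VASS.Code 2 m) := fun n q L =>
    (Computable.const n).pair (((Computable.const q).pair
      VectorMachine.computable_initial_counters).pair
        ((Computable.const []).pair (Computable.const L)))
  have hval : ∀ c, ∃ b ∈ f ((n₁, (q₁, u c), [], L₁), (n₂, (q₂, u c), [], L₂)),
      (b = true ↔ ¬ (c.eval 0).Dom) := by
    intro c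
    obtain ⟨hdet, hhalt, hnot⟩ := hL (u c)
    obtain ⟨b, hb, hbR⟩ := hdec ((n₁, (q₁, u c), [], L₁), (n₂, (q₂, u c), [], L₂)) hdet
    refine ⟨b, hb, hbR.trans ?_⟩
    rw [← hM c]
    -- Halting separates the trace languages and excludes `R`; divergence gives two-sided simulation
    -- and forces `R`.
    exact ⟨fun h h' => hlang _ _ (hhalt h') h, fun h => hsim _ _ (hnot h)⟩
  -- The partial algorithm is defined on every instance of the reduction, because the first VASS is
  -- always deterministic. Composing it with the reduction therefore gives a total decision
  -- procedure.
  choose g hg hgR using hval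
  have hgc : Computable g :=
    (hf.comp ((hcomp n₁ q₁ L₁).pair (hcomp n₂ q₂ L₂))).of_eq_tot hg
  have hnot : ComputablePred fun c : Nat.Partrec.Code => ¬ (c.eval 0).Dom :=
    ComputablePred.computable_iff.2 ⟨g, hgc, funext fun c => propext (hgR c).symm⟩
  exact ComputablePred.halting_problem 0 (hnot.not.of_eq fun c => not_not)
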